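/- **Setting.** Let $Fr(\omega_2)$ be the free Boolean algebra with free generators $(a_\xi)_{\xi<\omega_2}$ and $Co(\omega_2)$ its completion; for $A\subseteq\omega_2$ let $Co(A)\subseteq Co(\omega_2)$ be the completion of the subalgebra generated by $(a_\xi)_{\xi\in A}$. Let $K$ be the Stone space of $Co(\omega_2)$ (points are ultrafilters). For a compact space $X$, $C_I(X)$ is the set of $f\in C(X)$ with values in $[0,1]$. A function $f\in C(K)$ *depends on* $A\subseteq\omega_2$ if $x\cap Co(A)=y\cap Co(A)$ implies $f(x)=f(y)$. For $\alpha<\omega_2$ let $d_\alpha\in C_I(K)$ be $d_\alpha(x)=\sum_{i\in\mathbb N}t_x(i)/2^{i+1}$, where $t_x(i)=1$ if $a_{\alpha+i}\in x$ and $t_x(i)=0$ otherwise. A bijection $\sigma$ of $\omega_2$ induces the automorphism $h(\sigma)$ of $Co(\omega_2)$ with $h(\sigma)(a_\xi)=a_{\sigma(\xi)}$ and the homeomorphism $\phi(\sigma)$ of $K$ with $\phi(\sigma)(u)=h(\sigma)^{-1}[u]$. For $\mathcal F\subseteq C_I(K)$ let $\Pi\mathcal F:K\to[0,1]^{\mathcal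 F}$, $(\Pi\mathcal F)(x)(f)=f(x)$, and $\nabla\mathcal F=(\Pi\mathcal F)[K]$; for $\mathcal G\subseteq\mathcal F$ let $\pi_{\mathcal G,\mathcal F}:\nabla\mathcal F\to\nabla\mathcal G$ be the restriction map. For $\xi<\omega_2$ and $A\subseteq B\subseteq\omega_2$, $\Sigma_{\xi,A}(B)$ is the set of bijections $\sigma$ of $\omega_2$ that are the identity on $\xi\cup(\omega_2\setminus B)$ and satisfy $\sigma[A]\cap(A\setminus\xi)=\emptyset$. An *ideal* of subsets of $A$ contains all finite subsets of $A$ and is closed under subsets and finite unions; it is *proper* if it does not contain $A$, and *countably generated* if it consists of all subsets of finite unions of members of some countable subfamily of it. $\mathbb P$ consists of the triples $p=(A_p,\mathcal F_p,\mathcal I_p)$ such that (1) $A_p\subseteq\omega_2$ is countable and $[\alpha,\alpha+\omega)\subseteq A_p$ for all $\alpha\in A_p$; (2) $\mathcal F_p\subseteq C_I(K)$ is countable and $d_\xi\in\mathcal F_p$ for every $\xi\in A_p$ that is $0$ or a limit ordinal; (3) $\mathcal I_p$ is a proper, countably generated ideal of subsets of $A_p$; (4) every $f\in\mathcal F_p$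 depends on some countable $S_f\in\mathcal I_p$; (5) for all finitely many $f_1,\dots,f_k\in\mathcal F_p$, all $\xi\in A_p$ and all $A\in\mathcal I_p$ there is $\sigma\in\Sigma_{\xi,A}(A_p)$ with $f_1\circ\phi(\sigma),\dots,f_k\circ\phi(\sigma)\in\mathcal F_p$; (6) $\nabla\mathcal F_p$ is connected. $\mathbb Q$ consists of the tuples $p=(A_p,\mathcal F_p,\mathcal I_p,\alpha_p,\mathcal X_p,\mathcal P_p)$ such that $(A_p,\mathcal F_p,\mathcal I_p)\in\mathbb P$; $\alpha_p$ is a countable ordinal; $\mathcal X_p=\{x^p_\beta:\beta<\alpha_p\}$ is a dense (indexed) subset of $\nabla\mathcal F_p$; and $\mathcal P_p$ is a countable family of pairs $(L,R)$ (*promises*) of disjoint subsets of $\alpha_p$ such that $\{x^p_\xi:\xi\in L\}$ and $\{x^p_\xi:\xi\in R\}$ are relatively discrete in $\nabla\mathcal F_p$ and $\overline{\{x^p_\xi:\xi\in L\}}\cap\overline{\{x^p_\xi:\xi\in R\}}\neq\emptyset$. The order is: $p\le q$ iff $A_p\supseteq A_q$, $\mathcal F_p\supseteq\mathcal F_q$,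 $\mathcal I_p\supseteq\mathcal I_q$, $\alpha_p\ge\alpha_q$, $\mathcal P_p\supseteq\mathcal P_q$ and $\pi_{\mathcal F_q,\mathcal F_p}(x^p_\beta)=x^q_\beta$ for all $\beta<\alpha_q$. For $\mathcal F\subseteq C_I(K)$, a function $h\in C(\nabla\mathcal F)$ is the *indestructible supremum* of functions $f_i\in C_I(\nabla\mathcal F)$ if $h$ is their supremum in the lattice $C(\nabla\mathcal F)$ and, for every $\mathcal G$ with $\mathcal F\subseteq\mathcal G\subseteq C_I(K)$, $h\circ\pi_{\mathcal F,\mathcal G}$ is the supremum of the $f_i\circ\pi_{\mathcal F,\mathcal G}$ in $C(\nabla\mathcal G)$. **Main extension lemma.** Let $p\in\mathbb Q$. Let $(f_n)_{n\in\mathbb N}$ be a sequence in $C_I(\nabla\mathcal F_p)$ with $f_nf_m=0$ for $n\ne m$, and let $(\xi_m)_{m\in\mathbb N}$ be a sequence of distinct ordinals below $\alpha_p$ such that $\{x^p_{\xi_m}:m\in\mathbb N\}$ is relatively discrete and $f_n(x^p_{\xi_m})=0$ for all $n,m\in\mathbb N$. Then there is an infinite $A\subseteq\mathbb N$ such that for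 every infinite $A'\subseteq A$ there is $q_{A'}\in\mathbb Q$, $q_{A'}\le p$, such that (a) some $f\in C_I(\nabla\mathcal F_{q_{A'}})$ is the indestructible supremum of $(f_i\circ\pi_{\mathcal F_p,\mathcal F_{q_{A'}}})_{i\in A'}$, and $\nabla\mathcal F_{q_{A'}}$ is connected; (b) $(\{\xi_n:n\in A'\},\{\xi_n:n\in\mathbb N\setminus A'\})\in\mathcal P_{q_{A'}}$. -/

import Mathlib

noncomputable section

namespace ExtLemma

open Set TopologicalSpace

/-! ### The index set of ordinals below the second uncountable cardinal -/

/-- The ordinal `ω₂`, regarded as the set of all smaller ordinals. -/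
abbrev Omega2 : Type 1 := Set.Iio (Ordinal.omega 2 : Ordinal.{0})

/-- The ordinal `α + n` for `α < ω₂`. -/
def Omega2.addNat (α : Omega2) (n : ℕ) : Omega2 :=
  ⟨α.1 + n, (Cardinal.isSuccLimit_omega 2).add_natCast_lt α.2 n⟩

/-! ### The completion of the free Boolean algebra on `ω₂` generators -/

/-- The Cantor cube of weight `ω₂`, the Stone space of the free Boolean algebra. -/
abbrev Cube : Type 1 := Omega2 → Bool

/-- `Co(ω₂)`, the completion of the free Boolean algebra on `ω₂` generators, realized as the
Boolean algebra of regular open subsets of the Cantor cube (in the Heyting algebra of open sets,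
the pseudocomplement is the interior of the complement, and `Heyting.Regular` consists of
the `U` that equal their double pseudocomplement). -/
abbrev Co : Type 1 := Heyting.Regular (Opens Cube)

/-- `Co(A)` as a subalgebra of `Co(ω₂)`: the regular open sets determined by the coordinates
in `A`, that is, the preimages of the regular open subsets of `2 ^ A`. -/
def CoSub (A : Set Omega2) : Set Co :=
  {b | ∀ x y : Cube, (∀ ξ ∈ A, x ξ = y ξ) → (x ∈ (b : Opens Cube) ↔ y ∈ (b : Opens Cube))}

/-- The clopen set `{x : x ξ = c}`. -/
def coordOpen (ξ : Omega2) (c : Bool) : Opens Cube :=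
  ⟨{x | x ξ = c},
    (isOpen_discrete ({c} : Set Bool)).preimage (continuous_apply (A := fun _ => Bool) ξ)⟩

theorem mem_coordOpen {ξ : Omega2} {c : Bool} {x : Cube} : x ∈ coordOpen ξ c ↔ x ξ = c := .rfl

theorem coordOpen_compl (ξ : Omega2) (c : Bool) : (coordOpen ξ c)ᶜ = coordOpen ξ (!c) := by
  refine IsCompl.compl_eq (IsCompl.of_eq (Opens.ext ?_) (Opens.ext ?_))
  · ext x
    cases c <;> simp [mem_coordOpen]
  · ext x
    cases c <;> simp [mem_coordOpen]

/-- The free generator `a_ξ`. -/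
def gen (ξ : Omega2) : Co :=
  ⟨coordOpen ξ true, by
    rw [Heyting.IsRegular, coordOpen_compl, coordOpen_compl]; rfl⟩

/-! ### Stone spaces -/

/-- The Stone space of a Boolean algebra: its points are the ultrafilters. -/
def Stone (B : Type*) [BooleanAlgebra B] : Type _ :=
  {u : Set B // ⊤ ∈ u ∧ (∀ a b, a ∈ u → a ≤ b → b ∈ u) ∧ (∀ a b, a ∈ u → b ∈ u → a ⊓ b ∈ u) ∧
    ∀ a, aᶜ ∈ u ↔ a ∉ u}

/-- The basic set `[a]` of the Stone space. -/
def Stone.basic {B : Type*} [BooleanAlgebra B] (a : B) : Set (Stone B) := {u | a ∈ u.1}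

instance {B : Type*} [BooleanAlgebra B] : TopologicalSpace (Stone B) :=
  generateFrom (range Stone.basic)

theorem Stone.isOpen_basic {B : Type*} [BooleanAlgebra B] (a : B) :
    IsOpen (Stone.basic a) := isOpen_generateFrom_of_mem ⟨a, rfl⟩

theorem Stone.isClopen_basic {B : Type*} [BooleanAlgebra B] (a : B) :
    IsClopen (Stone.basic a) := by
  refine ⟨⟨?_⟩, Stone.isOpen_basic a⟩
  have : (Stone.basic a)ᶜ = Stone.basic aᶜ := by
    ext u
    exact (u.2.2.2.2 a).symm
  rw [this]
  exact Stone.isOpen_basic _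

/-- The space `K`, the Stone space of `Co(ω₂)`. -/
abbrev K : Type 1 := Stone Co

/-- `C_I(X)`: the continuous real functions on `X` with values in `[0,1]`. -/
def CI (X : Type*) [TopologicalSpace X] : Set C(X, ℝ) := {f | ∀ x, f x ∈ Icc (0 : ℝ) 1}

/-- `f` depends on `A`: the value `f x` is determined by `x ∩ Co(A)`. -/
def DependsOn (f : C(K, ℝ)) (A : Set Omega2) : Prop :=
  ∀ x y : K, x.1 ∩ CoSub A = y.1 ∩ CoSub A → f x = f y

/-! ### The functions `d_α` -/

open Classical in
/-- The `i`-th summand of `d_α`: it is `2 ^ (-(i+1))` if `a_{α+i} ∈ x`, and `0` otherwise. -/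
def dTerm (α : Omega2) (i : ℕ) (x : K) : ℝ :=
  (if gen (α.addNat i) ∈ x.1 then 1 else 0) / 2 ^ (i + 1)

theorem continuous_dTerm (α : Omega2) (i : ℕ) : Continuous (dTerm α i) := by
  classical
  unfold dTerm
  refine Continuous.div_const (continuous_const.if (fun a ha => ?_) continuous_const) _
  have hc : frontier {x : K | gen (α.addNat i) ∈ x.1} = ∅ :=
    (Stone.isClopen_basic (gen (α.addNat i))).frontier_eq
  rw [hc] at ha
  exact ha.elim

theorem dTerm_bound (α : Omega2) (i : ℕ) (x : K) : ‖dTerm α i x‖ ≤ 1 / 2 * (1 / 2) ^ i := by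
  classical
  unfold dTerm
  have h2 : (1 : ℝ) / 2 * (1 / 2) ^ i = 1 / 2 ^ (i + 1) := by
    rw [one_div_pow, pow_succ]; field_simp
  rw [h2]
  split_ifs
  · rw [Real.norm_of_nonneg (by positivity)]
  · simp

/-- `d_α(x) = ∑ i, t_x(i) / 2 ^ (i+1)`, where `t_x(i) = 1` if `a_{α+i} ∈ x` and `t_x(i) = 0`
otherwise. -/
def d (α : Omega2) : C(K, ℝ) where
  toFun x := ∑' i, dTerm α i x
  continuous_toFun :=
    continuous_tsum (continuous_dTerm α)
      ((summable_geometric_of_lt_one (by norm_num) (by norm_num)).mul_left (1 / 2))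
      (dTerm_bound α)

/-! ### Homeomorphisms induced by bijections of `ω₂` -/

/-- The homeomorphism `x ↦ x ∘ σ` of the Cantor cube. -/
def cubeHomeo (σ : Equiv.Perm Omega2) : Cube ≃ₜ Cube where
  toFun x := fun ξ => x (σ ξ)
  invFun x := fun ξ => x (σ.symm ξ)
  left_inv x := by simp
  right_inv x := by simp
  continuous_toFun := by fun_prop
  continuous_invFun := by fun_prop

/-- `U ↦ {x : x ∘ σ ∈ U}` on open sets. -/
def openIso (σ : Equiv.Perm Omega2) : Opens Cube ≃o Opens Cube := (cubeHomeo σ).symm.opensCongr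

theorem openIso_compl (e : Opens Cube ≃o Opens Cube) (U : Opens Cube) : e Uᶜ = (e U)ᶜ :=
  map_compl e U

/-- The automorphism `aut(σ)` of `Co(ω₂)` that sends `a_ξ` to `a_{σ(ξ)}`. -/
def aut (σ : Equiv.Perm Omega2) : Co ≃o Co where
  toFun b := ⟨openIso σ b, by
    rw [Heyting.IsRegular, ← openIso_compl, ← openIso_compl, b.prop.eq]⟩
  invFun b := ⟨(openIso σ).symm b, by
    rw [Heyting.IsRegular, ← openIso_compl, ← openIso_compl, b.prop.eq]⟩
  left_inv b := Heyting.Regular.coe_injective ((openIso σ).symm_apply_apply _)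
  right_inv b := Heyting.Regular.coe_injective ((openIso σ).apply_symm_apply _)
  map_rel_iff' := (openIso σ).map_rel_iff

theorem aut_gen (σ : Equiv.Perm Omega2) (ξ : Omega2) : aut σ (gen ξ) = gen (σ ξ) := by
  apply Heyting.Regular.coe_injective
  ext x
  rfl

/-- The map `φ(σ)` of `K` dual to `aut(σ)`, given by `φ(σ)(u) = aut(σ)⁻¹[u]`. -/
def phi (σ : Equiv.Perm Omega2) : C(K, K) where
  toFun u := ⟨{b | aut σ b ∈ u.1}, by
    obtain ⟨u, h1, h2, h3, h4⟩ := u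
    refine ⟨?_, fun a b ha hab => ?_, fun a b ha hb => ?_, fun a => ?_⟩
    · simpa using h1
    · exact h2 _ _ ha ((aut σ).monotone hab)
    · simpa only [mem_ofPred_eq, OrderIso.map_inf] using h3 _ _ ha hb
    · simpa [map_compl] using h4 (aut σ a)⟩
  continuous_toFun := by
    refine continuous_generateFrom_iff.2 ?_
    rintro _ ⟨b, rfl⟩
    exact Stone.isOpen_basic (aut σ b)

/-! ### The spaces `∇F` -/

/-- `ΠF : K → [0,1]^F`, `(ΠF x)(f) = f(x)`. -/
def PiMap (F : Set C(K, ℝ)) (x : K) : F → ℝ := fun f => f.1 x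

/-- `∇F`, the image of `ΠF`. -/
def nabla (F : Set C(K, ℝ)) : Set (F → ℝ) := range (PiMap F)

/-- The projection `π_{GF} : ∇F → ∇G` for `G ⊆ F`. -/
def proj {G F : Set C(K, ℝ)} (hGF : G ⊆ F) : C(nabla F, nabla G) where
  toFun t := ⟨fun g => t.1 ⟨g.1, hGF g.2⟩, by
    obtain ⟨t, x, rfl⟩ := t
    exact ⟨x, rfl⟩⟩
  continuous_toFun := by
    refine Continuous.subtype_mk (continuous_pi fun g => ?_) _
    exact (continuous_apply (A := fun _ : F => ℝ) ⟨g.1, hGF g.2⟩).comp continuous_subtype_val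

theorem proj_refl (F : Set C(K, ℝ)) (t : nabla F) : proj Subset.rfl t = t := rfl

theorem proj_proj {F G H : Set C(K, ℝ)} (hFG : F ⊆ G) (hGH : G ⊆ H) (t : nabla H) :
    proj hFG (proj hGH t) = proj (hFG.trans hGH) t := rfl

/-! ### Ideals -/

/-- `I` is an ideal of subsets of `A`; ideals contain all finite subsets of `A`. -/
structure IsIdealOn (A : Set Omega2) (I : Set (Set Omega2)) : Prop where
  subset : ∀ B ∈ I, B ⊆ A
  finite : ∀ B ⊆ A, B.Finite → B ∈ I
  union : ∀ B ∈ I, ∀ C ∈ I, B ∪ C ∈ I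
  mono : ∀ B ∈ I, ∀ C ⊆ B, C ∈ I

/-- `⟨J⟩`: all subsets of finite unions of elements of `J`. -/
def idealSpan (J : Set (Set Omega2)) : Set (Set Omega2) :=
  {B | ∃ T ⊆ J, T.Finite ∧ B ⊆ ⋃₀ T}

/-- `I` is generated by a countable subfamily. -/
def CountablyGenerated (I : Set (Set Omega2)) : Prop :=
  ∃ J ⊆ I, J.Countable ∧ idealSpan J = I

/-! ### The auxiliary partial order `ℙ` -/

/-- `Σ_{ξ,A}(B)`: the bijections `σ` of `ω₂` with `σ[A] ∩ (A \ ξ) = ∅` that are the identity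
on `ξ ∪ (ω₂ \ B)`. -/
def Sig (ξ : Omega2) (A B : Set Omega2) : Set (Equiv.Perm Omega2) :=
  {σ | σ '' A ∩ (A \ Iio ξ) = ∅ ∧ ∀ γ ∈ Iio ξ ∪ Bᶜ, σ γ = γ}

/-- The conditions of the auxiliary partial order `ℙ`. -/
structure PCond where
  /-- the set `A_p` -/
  A : Set Omega2
  /-- the family `F_p` -/
  F : Set C(K, ℝ)
  /-- the ideal `I_p` -/
  I : Set (Set Omega2)
  countable_A : A.Countable
  block : ∀ α ∈ A, ∀ n : ℕ, α.addNat n ∈ A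
  countable_F : F.Countable
  F_subset : F ⊆ CI K
  /-- `d_ξ ∈ F_p` for all `ξ ∈ A_p` that are `0` or a limit ordinal -/
  d_mem : ∀ ξ ∈ A, Order.IsSuccPrelimit ξ.1 → d ξ ∈ F
  ideal : IsIdealOn A I
  proper : A ∉ I
  countablyGenerated : CountablyGenerated I
  depends : ∀ f ∈ F, ∃ S ∈ I, S.Countable ∧ DependsOn f S
  moves : ∀ s ⊆ F, s.Finite → ∀ ξ ∈ A, ∀ B ∈ I, ∃ σ ∈ Sig ξ B A, ∀ f ∈ s, f.comp (phi σ) ∈ F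
  connected : IsConnected (nabla F)

/-- `p ≤ q` in `ℙ` if all three coordinates of `p` contain those of `q`. -/
instance : Preorder PCond where
  le p q := q.A ⊆ p.A ∧ q.F ⊆ p.F ∧ q.I ⊆ p.I
  le_refl _ := ⟨Subset.rfl, Subset.rfl, Subset.rfl⟩
  le_trans _ _ _ h₁ h₂ :=
    ⟨h₂.1.trans h₁.1, h₂.2.1.trans h₁.2.1, h₂.2.2.trans h₁.2.2⟩

/-! ### The partial order `ℚ` -/

/-- The set of points `{x_ξ : ξ ∈ L}`, for a set `L` of ordinals below `α`. -/
def pts {X : Type*} {α : Ordinal.{0}} (x : Iio α → X) (L : Set Ordinal.{0}) : Set X :=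
  x '' {β | β.1 ∈ L}

/-- The conditions of `ℚ`. -/
structure QCond extends PCond where
  /-- the countable ordinal `α_p` -/
  α : Ordinal.{0}
  /-- the points `x^p_β`, `β < α_p` -/
  x : Iio α → nabla F
  /-- the promises -/
  P : Set (Set Ordinal.{0} × Set Ordinal.{0})
  α_countable : α < Ordinal.omega 1
  dense : DenseRange x
  countable_P : P.Countable
  promise_subset : ∀ LR ∈ P, LR.1 ⊆ Iio α ∧ LR.2 ⊆ Iio α
  promise_disjoint : ∀ LR ∈ P, Disjoint LR.1 LR.2
  promise_discrete : ∀ LR ∈ P, DiscreteTopology (pts x LR.1) ∧ DiscreteTopology (pts x LR.2)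
  promise_closure : ∀ LR ∈ P, (closure (pts x LR.1) ∩ closure (pts x LR.2)).Nonempty

/-- The order of `ℚ`: `p` extends `q`. -/
structure QCond.Le (p q : QCond) : Prop where
  toP : p.toPCond ≤ q.toPCond
  α_le : q.α ≤ p.α
  P_subset : q.P ⊆ p.P
  x_restrict : ∀ β : Iio q.α, proj toP.2.1 (p.x ⟨β.1, β.2.trans_le α_le⟩) = q.x β

instance : Preorder QCond where
  le := QCond.Le
  le_refl _ := ⟨le_rfl, le_rfl, Subset.rfl, fun _ => proj_refl _ _⟩
  le_trans _ _ _ h₁ h₂ :=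
    ⟨h₁.toP.trans h₂.toP, h₂.α_le.trans h₁.α_le, h₂.P_subset.trans h₁.P_subset, fun β => by
      rw [← h₂.x_restrict β, ← h₁.x_restrict, proj_proj]⟩

theorem QCond.F_subset_of_le {p q : QCond} (hpq : p ≤ q) : q.F ⊆ p.F :=
  (show QCond.Le p q from hpq).toP.2.1

/-! ### Indestructible suprema -/

/-- `g` is the supremum of the `f i` in the lattice `C(∇F)`, and for every
family `G ⊆ C_I(K)` that contains `F`, the function `g ∘ π_{FG}` is the supremum of the functions
`f i ∘ π_{FG}` in `C(∇G)`. -/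
def IsIndestructibleSup {ι : Type*} {F : Set C(K, ℝ)} (f : ι → C(nabla F, ℝ))
    (g : C(nabla F, ℝ)) : Prop :=
  IsLUB (range f) g ∧
    ∀ (G : Set C(K, ℝ)) (hFG : F ⊆ G), G ⊆ CI K →
      IsLUB (range fun i => (f i).comp (proj hFG)) (g.comp (proj hFG))

end ExtLemma

end

noncomputable section

namespace ExtLemma

open Set TopologicalSpace

/-! ### Stone spaces: compactness, a basis, existence of ultrafilters -/

section StoneSpace

variable {B : Type*} [BooleanAlgebra B]

/-! The supremum `g` of the `f i`, `i ∈ A'`, is formed in `C(K)`, where it exists because `K` is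
extremally disconnected (`continuous_envelope`). It is then a supremum over all of `K`, so it stays
one in `C(∇G)` for every `G` that contains it and `F_p`: indestructibility is automatic
(`isIndestructibleSup_coord`). The work lies in a condition that contains `g`, has connected `∇`,
and keeps the promises.

To restore closure under moves, copies of `p.A` are stacked above it in `ω₂`, with a countable
family of permutations any two of which agree on an initial segment of `p.A` and have disjoint
images above it (`nonempty_moveSystem`). The new family consists of all `a ∘ φ(h)` with `a ∈ F_p ∪
{g}` and `h` a move. Without `g` its `∇` is connected: clause (5) for `p`, used repeatedly, realizes
the coincidence pattern of finitely many moves by permutations that keep the given functions in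
`F_p` (`PCond.exists_realization`), so `ε`-chains in `∇F_p` can be transported
(`PCond.isConnected_copies`).

To include `g`, the set `A` is thinned by a diagonal argument (`exists_selection`). By disjointness,
of two suprema over disjoint index sets at most one is nonzero at a given point
(`envelope_eq_zero_or`); hence the supremum over some tail of `A` can be made to vanish at each of
countably many prescribed points, and there `g` is a finite partial sum. A chain for finitely many
old functions is rounded to a finite net of such points, where the steps of `g` are controlled by
those of finitely many `f i` (`isConnected_copies_insert`).

For the promises, each point of `∇F_p` is lifted to an ultrafilter that induces it along every copy
(`MoveSystem.exists_lift`); the same truncation to partial sums keeps closure relations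
(`lift_mem_closure`). For the new promise, `A` lies in the index set of a convergent subsequence of
the `x_{ξ_m}` with infinite complement there, so both halves accumulate at its limit. -/

theorem Stone.mem_inf {u : Stone B} {a b : B} : a ⊓ b ∈ u.1 ↔ a ∈ u.1 ∧ b ∈ u.1 :=
  ⟨fun h => ⟨u.2.2.1 _ _ h inf_le_left, u.2.2.1 _ _ h inf_le_right⟩,
    fun h => u.2.2.2.1 _ _ h.1 h.2⟩

theorem Stone.mem_compl {u : Stone B} {a : B} : aᶜ ∈ u.1 ↔ a ∉ u.1 := u.2.2.2.2 a

theorem Stone.bot_notMem (u : Stone B) : ⊥ ∉ u.1 := by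
  rw [← Stone.mem_compl, compl_bot]
  exact u.2.1

theorem Stone.basic_inf (a b : B) : Stone.basic (a ⊓ b) = Stone.basic a ∩ Stone.basic b := by
  ext u
  exact Stone.mem_inf

theorem Stone.isTopologicalBasis : IsTopologicalBasis (range (Stone.basic (B := B))) where
  exists_subset_inter := by
    rintro _ ⟨a, rfl⟩ _ ⟨b, rfl⟩ u hu
    exact ⟨_, ⟨a ⊓ b, rfl⟩, by rwa [Stone.basic_inf], (Stone.basic_inf a b).subset⟩
  sUnion_eq := eq_univ_of_forall fun u => ⟨_, ⟨⊤, rfl⟩, u.2.1⟩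
  eq_generateFrom := rfl

theorem Stone.exists_basic_subset {O : Set (Stone B)} (hO : IsOpen O) {u : Stone B} (hu : u ∈ O) :
    ∃ b ∈ u.1, Stone.basic b ⊆ O := by
  obtain ⟨_, ⟨b, rfl⟩, hb, hbO⟩ := Stone.isTopologicalBasis.exists_subset_of_mem_open hu hO
  exact ⟨b, hb, hbO⟩

instance : CompactSpace (Stone B) := by
  refine ⟨isCompact_iff_ultrafilter_le_nhds.2 fun f _ => ?_⟩
  refine ⟨⟨{b | Stone.basic b ∈ f}, ?_, ?_, ?_, ?_⟩, mem_univ _, ?_⟩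
  · have : Stone.basic (⊤ : B) = univ := eq_univ_of_forall fun u => u.2.1
    rw [mem_ofPred_eq, this]
    exact Filter.univ_mem
  · exact fun a b ha hab => Filter.mem_of_superset ha fun u hu => u.2.2.1 _ _ hu hab
  · intro a b ha hb
    rw [mem_ofPred_eq, Stone.basic_inf]
    exact Filter.inter_mem ha hb
  · intro a
    have : Stone.basic aᶜ = (Stone.basic a)ᶜ := by
      ext u
      exact Stone.mem_compl
    rw [mem_ofPred_eq, this]
    exact Ultrafilter.compl_mem_iff_notMem
  · refine (Stone.isTopologicalBasis.nhds_hasBasis.ge_iff).2 ?_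
    rintro _ ⟨⟨b, rfl⟩, hb⟩
    exact hb

/-- A downward directed family of nonzero elements extends to an ultrafilter. -/
theorem Stone.exists_superset {s : Set B} (hne : s.Nonempty)
    (hdir : ∀ a ∈ s, ∀ b ∈ s, ∃ c ∈ s, c ≤ a ⊓ b) (hbot : ⊥ ∉ s) : ∃ u : Stone B, s ⊆ u.1 := by
  let F : Order.PFilter B := ⟨⟨⟨{b | ∃ a ∈ s, a ≤ OrderDual.ofDual b}, by
      rintro a b hab ⟨c, hc, hca⟩
      exact ⟨c, hc, hca.trans hab⟩⟩, by
      obtain ⟨a, ha⟩ := hne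
      exact ⟨OrderDual.toDual a, a, ha, le_rfl⟩, by
      rintro a ⟨a', ha', haa⟩ b ⟨b', hb', hbb⟩
      obtain ⟨c, hc, hcab⟩ := hdir a' ha' b' hb'
      exact ⟨OrderDual.toDual c, ⟨c, hc, le_rfl⟩, (hcab.trans inf_le_left).trans haa,
        (hcab.trans inf_le_right).trans hbb⟩⟩⟩
  have hF : ∀ b, b ∈ F ↔ ∃ a ∈ s, a ≤ b := fun b => Iff.rfl
  have hdisj : Disjoint (F : Set B) ((⊥ : Order.Ideal B) : Set B) := by
    rw [Set.disjoint_left]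
    rintro b hb hb'
    obtain ⟨a, ha, hab⟩ := (hF b).1 hb
    have : b = ⊥ := le_bot_iff.1 hb'
    subst this
    exact hbot (le_bot_iff.1 hab ▸ ha)
  obtain ⟨J, hJ, -, hFJ⟩ := DistribLattice.prime_ideal_of_disjoint_filter_ideal hdisj
  refine ⟨⟨(J : Set B)ᶜ, ?_, ?_, ?_, ?_⟩, fun a ha => ?_⟩
  · exact hJ.toIsProper.top_notMem
  · exact fun a b ha hab hb => ha (J.lower hab hb)
  · exact fun a b ha hb hab => (hJ.mem_or_mem hab).elim ha hb
  · intro a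
    have h1 := hJ.mem_or_compl_mem (x := a)
    have h2 : ¬ (a ∈ J ∧ aᶜ ∈ J) := fun h => hJ.toIsProper.top_notMem (by
      have := J.sup_mem h.1 h.2
      rwa [sup_compl_eq_top] at this)
    simp only [mem_compl_iff, SetLike.mem_coe]
    tauto
  · exact Set.disjoint_left.1 hFJ ((hF a).2 ⟨a, ha, le_rfl⟩)

theorem Stone.basic_nonempty {b : B} (hb : b ≠ ⊥) : (Stone.basic b).Nonempty := by
  obtain ⟨u, hu⟩ := Stone.exists_superset (s := {b}) (singleton_nonempty b)
    (by simp) (by simpa using hb.symm)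
  exact ⟨u, hu rfl⟩

end StoneSpace

/-! ### The algebras `Co(A)` and amalgamation of ultrafilters -/

theorem Co.mem_inf {a b : Co} {x : Cube} :
    x ∈ ((a ⊓ b : Co) : Opens Cube) ↔ x ∈ (a : Opens Cube) ∧ x ∈ (b : Opens Cube) := Iff.rfl

theorem Co.eq_bot_iff {a : Co} : a = ⊥ ↔ ∀ x, x ∉ (a : Opens Cube) := by
  rw [← Heyting.Regular.coe_inj, Heyting.Regular.coe_bot, ← SetLike.coe_set_eq]
  exact Set.eq_empty_iff_forall_notMem

theorem Co.mem_compl {U : Opens Cube} {x : Cube} :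
    x ∈ Uᶜ ↔ x ∈ interior (U : Set Cube)ᶜ := by
  rw [← Opens.coe_compl_eq_interior_compl]
  rfl

theorem CoSub_mono {A B : Set Omega2} (h : A ⊆ B) : CoSub A ⊆ CoSub B :=
  fun _ hb x y hxy => hb x y fun ξ hξ => hxy ξ (h hξ)

theorem inf_mem_CoSub {A : Set Omega2} {a b : Co} (ha : a ∈ CoSub A) (hb : b ∈ CoSub A) :
    a ⊓ b ∈ CoSub A := fun x y hxy => by
  rw [Co.mem_inf, Co.mem_inf, ha x y hxy, hb x y hxy]

theorem top_mem_CoSub (A : Set Omega2) : (⊤ : Co) ∈ CoSub A := fun _ _ _ => Iff.rfl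

open Classical in
/-- The point that equals `x` on `A` and `y` off `A`. -/
def glue (A : Set Omega2) (x y : Cube) : Cube := fun ξ => if ξ ∈ A then x ξ else y ξ

theorem continuous_glue (A : Set Omega2) (y : Cube) : Continuous fun x => glue A x y := by
  refine continuous_pi fun ξ => ?_
  unfold glue
  split_ifs <;> fun_prop

theorem glue_of_mem {A : Set Omega2} {x y : Cube} {ξ : Omega2} (h : ξ ∈ A) :
    glue A x y ξ = x ξ := if_pos h

theorem glue_of_notMem {A : Set Omega2} {x y : Cube} {ξ : Omega2} (h : ξ ∉ A) :
    glue A x y ξ = y ξ := if_neg h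

/-- The interior of a set determined by the coordinates in `A` is so determined. -/
theorem mem_interior_of_eqOn {A : Set Omega2} {M : Set Cube}
    (hM : ∀ x y : Cube, (∀ ξ ∈ A, x ξ = y ξ) → x ∈ M → y ∈ M) {x y : Cube}
    (hxy : ∀ ξ ∈ A, x ξ = y ξ) (hx : x ∈ interior M) : y ∈ interior M := by
  rw [mem_interior] at hx ⊢
  obtain ⟨t, htM, ht, hxt⟩ := hx
  refine ⟨(fun z => glue A z x) ⁻¹' t, fun z hz => ?_, ht.preimage (continuous_glue A x), ?_⟩
  · exact hM (glue A z x) z (fun ξ hξ => glue_of_mem hξ) (htM hz)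
  · have : glue A y x = x := by
      ext ξ
      by_cases h : ξ ∈ A
      · rw [glue_of_mem h, hxy ξ h]
      · rw [glue_of_notMem h]
    rwa [mem_preimage, this]

/-- A pseudocomplement is the interior of a complement, and both complements and interiors preserve
dependence on the coordinates in `A`; regularization applies this twice. -/
theorem toRegular_mem_CoSub {A : Set Omega2} {U : Opens Cube}
    (hU : ∀ x y : Cube, (∀ ξ ∈ A, x ξ = y ξ) → x ∈ U → y ∈ U) :
    Heyting.Regular.toRegular U ∈ CoSub A := by
  have key : ∀ V : Opens Cube, (∀ x y : Cube, (∀ ξ ∈ A, x ξ = y ξ) → x ∈ V → y ∈ V) →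
      ∀ x y : Cube, (∀ ξ ∈ A, x ξ = y ξ) → x ∈ Vᶜ → y ∈ Vᶜ := by
    intro V hV x y hxy hx
    rw [Co.mem_compl] at hx ⊢
    refine mem_interior_of_eqOn (M := (V : Set Cube)ᶜ) (fun a b hab ha hb => ?_) hxy hx
    exact ha (hV b a (fun ξ hξ => (hab ξ hξ).symm) hb)
  intro x y hxy
  rw [Heyting.Regular.coe_toRegular]
  exact ⟨key _ (key _ hU) x y hxy, key _ (key _ hU) y x fun ξ hξ => (hxy ξ hξ).symm⟩

theorem compl_mem_CoSub {A : Set Omega2} {a : Co} (ha : a ∈ CoSub A) : aᶜ ∈ CoSub A := by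
  have := toRegular_mem_CoSub (A := A) (U := (a : Opens Cube)ᶜ) (fun x y hxy hx => by
    rw [Co.mem_compl] at hx ⊢
    exact mem_interior_of_eqOn (M := ((a : Opens Cube) : Set Cube)ᶜ)
      (fun a' b' hab ha' hb' => ha' ((ha _ _ hab).2 hb')) hxy hx)
  rwa [← Heyting.Regular.coe_compl, Heyting.Regular.toRegular_coe] at this

/-- `Co(A)` is closed under complements, so the trace of an ultrafilter on it is maximal and an
inclusion of traces is an equality. -/
theorem inter_CoSub_eq {A : Set Omega2} {u w : K} (h : u.1 ∩ CoSub A ⊆ w.1) :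
    w.1 ∩ CoSub A = u.1 ∩ CoSub A := by
  refine Subset.antisymm (fun a ha => ⟨?_, ha.2⟩) fun a ha => ⟨h ha, ha.2⟩
  by_contra hau
  exact Stone.mem_compl.1 (h ⟨Stone.mem_compl.2 hau, compl_mem_CoSub ha.2⟩) ha.1

/-- Every element of `Co(A)` has an upper bound in `Co(A ∩ B)` that is disjoint from the same
elements of `Co(B)`. -/
theorem exists_separating {A : Set Omega2} (B : Set Omega2) {a : Co} (ha : a ∈ CoSub A) :
    ∃ e ∈ CoSub (A ∩ B), a ≤ e ∧ ∀ b ∈ CoSub B, a ⊓ b = ⊥ → e ⊓ b = ⊥ := by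
  -- The projection of `a` to the coordinates in `A ∩ B`, viewed as a cylinder; its regularization
  -- will be the witness.
  let U : Opens Cube := ⟨⋃ z : Cube, (fun x => glue (A ∩ B) x z) ⁻¹' ((a : Opens Cube) : Set Cube),
    isOpen_iUnion fun z => (a : Opens Cube).isOpen.preimage (continuous_glue _ z)⟩
  have hmem : ∀ x, x ∈ U ↔ ∃ z, glue (A ∩ B) x z ∈ (a : Opens Cube) := fun x => mem_iUnion
  have haU : (a : Opens Cube) ≤ U := fun x hx => (hmem x).2 ⟨x, by
    have : glue (A ∩ B) x x = x := by
      ext ξ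
      simp [glue]
    rwa [this]⟩
  have hUb : ∀ b ∈ CoSub B, a ⊓ b = ⊥ → U ⊓ (b : Opens Cube) = ⊥ := by
    intro b hb hab
    ext x
    refine iff_of_false ?_ (fun h => h)
    rintro ⟨hxU, hxb⟩
    obtain ⟨z, hz⟩ := (hmem x).1 hxU
    -- This point agrees on `A` with a member of `a` and on `B` with `x`, so it lies in `a` and in
    -- `b`.
    refine Co.eq_bot_iff.1 hab (glue A (glue (A ∩ B) x z) x) (Co.mem_inf.2 ⟨?_, ?_⟩)
    · exact (ha _ _ fun ξ hξ => glue_of_mem hξ).2 hz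
    · refine (hb _ _ fun ξ hξ => ?_).2 hxb
      by_cases h : ξ ∈ A
      · rw [glue_of_mem h, glue_of_mem (show ξ ∈ A ∩ B from ⟨h, hξ⟩)]
      · rw [glue_of_notMem h]
  refine ⟨Heyting.Regular.toRegular U, toRegular_mem_CoSub (U := U) fun x y hxy hx => ?_,
    (show (a : Opens Cube) ≤ Uᶜᶜ from haU.trans le_compl_compl), fun b hb hab => ?_⟩
  · obtain ⟨z, hz⟩ := (hmem x).1 hx
    refine (hmem y).2 ⟨z, ?_⟩
    have : glue (A ∩ B) y z = glue (A ∩ B) x z := by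
      ext ξ
      by_cases h : ξ ∈ A ∩ B
      · rw [glue_of_mem h, glue_of_mem h, hxy ξ h]
      · rw [glue_of_notMem h, glue_of_notMem h]
    rwa [this]
  · apply Heyting.Regular.coe_injective
    rw [Heyting.Regular.coe_inf, Heyting.Regular.coe_toRegular, Heyting.Regular.coe_bot,
      ← disjoint_iff, ← le_compl_iff_disjoint_right]
    have h := le_compl_iff_disjoint_right.2 (disjoint_iff.2 (hUb b hb hab))
    exact (compl_anti (compl_anti h)).trans (compl_compl_compl _).le

/-- Ultrafilters that agree on `Co(A ∩ B)` have a common amalgam over `Co(A)` and `Co(B)`. -/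
theorem exists_amalgam {A B : Set Omega2} {u v : K}
    (h : u.1 ∩ CoSub (A ∩ B) = v.1 ∩ CoSub (A ∩ B)) :
    ∃ w : K, w.1 ∩ CoSub A = u.1 ∩ CoSub A ∧ w.1 ∩ CoSub B = v.1 ∩ CoSub B := by
  obtain ⟨w, hw⟩ := Stone.exists_superset
    (s := {c : Co | ∃ a ∈ u.1 ∩ CoSub A, ∃ b ∈ v.1 ∩ CoSub B, a ⊓ b = c})
    ⟨_, ⊤, ⟨u.2.1, top_mem_CoSub A⟩, ⊤, ⟨v.2.1, top_mem_CoSub B⟩, rfl⟩ (by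
      rintro _ ⟨a, ha, b, hb, rfl⟩ _ ⟨a', ha', b', hb', rfl⟩
      exact ⟨_, ⟨a ⊓ a', ⟨Stone.mem_inf.2 ⟨ha.1, ha'.1⟩, inf_mem_CoSub ha.2 ha'.2⟩, b ⊓ b',
        ⟨Stone.mem_inf.2 ⟨hb.1, hb'.1⟩, inf_mem_CoSub hb.2 hb'.2⟩, rfl⟩,
        (inf_inf_inf_comm a a' b b').le⟩) (by
      rintro ⟨a, ha, b, hb, hab⟩
      obtain ⟨e, he, hae, heb⟩ := exists_separating B ha.2
      have : e ∈ v.1 ∩ CoSub (A ∩ B) := h ▸ ⟨u.2.2.1 _ _ ha.1 hae, he⟩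
      exact v.bot_notMem (heb b hb.2 hab ▸ Stone.mem_inf.2 ⟨this.1, hb.1⟩))
  refine ⟨w, inter_CoSub_eq fun a ha => hw ?_, inter_CoSub_eq fun b hb => hw ?_⟩
  · exact ⟨a, ha, ⊤, ⟨v.2.1, top_mem_CoSub B⟩, inf_top_eq a⟩
  · exact ⟨⊤, ⟨u.2.1, top_mem_CoSub A⟩, b, hb, top_inf_eq b⟩

theorem DependsOn.mono {f : C(K, ℝ)} {A B : Set Omega2} (hf : DependsOn f A) (h : A ⊆ B) :
    DependsOn f B := fun x y hxy => hf x y (by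
  rw [← inter_eq_self_of_subset_right (CoSub_mono h), ← inter_assoc, ← inter_assoc, hxy])

/-- Two ultrafilters that agree on `Co(A ∩ B)` are joined through an amalgam that agrees with one on
`Co(A)` and with the other on `Co(B)`. In `PCond.exists_realization` this permits a support to be
cut down until its images lie in the ideal. -/
theorem DependsOn.inter {f : C(K, ℝ)} {A B : Set Omega2} (hA : DependsOn f A)
    (hB : DependsOn f B) : DependsOn f (A ∩ B) := fun u v huv => by
  obtain ⟨w, hwu, hwv⟩ := exists_amalgam huv
  rw [← hA w u hwu, hB w v hwv]

/-! ### Disconnectedness of `K` -/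

/-- `K` is extremally disconnected, because `Co(ω₂)` is complete. -/
theorem isOpen_closure_of_isOpen {O : Set K} (hO : IsOpen O) : IsOpen (closure O) := by
  let U : Opens Cube := ⨆ b : {b : Co // Stone.basic b ⊆ O}, (b.1 : Opens Cube)
  -- The supremum in `Co(ω₂)` of all `b` with `[b] ⊆ O`; the closure of `O` is `[c]`.
  let c : Co := Heyting.Regular.toRegular U
  have hle : ∀ b : Co, Stone.basic b ⊆ O → b ≤ c := fun b hb =>
    (le_iSup (fun b : {b : Co // Stone.basic b ⊆ O} => (b.1 : Opens Cube)) ⟨b, hb⟩).trans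
      le_compl_compl
  have hc : ∀ a : Co, (∀ b : Co, Stone.basic b ⊆ O → b ≤ a) → c ≤ a := fun a ha =>
    Heyting.Regular.gi.gc.l_le (iSup_le fun b => ha b.1 b.2)
  have : closure O = Stone.basic c := by
    refine Subset.antisymm (closure_minimal (fun u hu => ?_) (Stone.isClopen_basic c).1)
      fun u hu => ?_
    · obtain ⟨b, hb, hbO⟩ := Stone.exists_basic_subset hO hu
      exact u.2.2.1 _ _ hb (hle b hbO)
    · rw [mem_closure_iff]
      intro V hV huV
      obtain ⟨a, ha, haV⟩ := Stone.exists_basic_subset hV huV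
      by_contra hne
      refine u.bot_notMem ?_
      have h1 : c ≤ aᶜ := hc _ fun b hb => by
        rw [le_compl_iff_disjoint_right, disjoint_iff]
        by_contra hab
        obtain ⟨w, hw⟩ := Stone.basic_nonempty hab
        exact hne ⟨w, haV (Stone.mem_inf.1 hw).2, hb (Stone.mem_inf.1 hw).1⟩
      exact (Stone.mem_compl.1 (u.2.2.1 _ _ hu h1) ha).elim
  rw [this]
  exact Stone.isOpen_basic c

/-! ### The action of permutations -/

theorem mem_aut {σ : Equiv.Perm Omega2} {b : Co} {x : Cube} :
    x ∈ (aut σ b : Opens Cube) ↔ (fun ξ => x (σ ξ)) ∈ (b : Opens Cube) := Iff.rfl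

theorem mem_phi {σ : Equiv.Perm Omega2} {u : K} {b : Co} : b ∈ (phi σ u).1 ↔ aut σ b ∈ u.1 :=
  Iff.rfl

theorem aut_mul (σ τ : Equiv.Perm Omega2) (b : Co) : aut (σ * τ) b = aut σ (aut τ b) := rfl

theorem phi_mul (σ τ : Equiv.Perm Omega2) : phi (σ * τ) = (phi τ).comp (phi σ) := rfl

theorem phi_one_apply (u : K) : phi 1 u = u := rfl

theorem comp_phi_one (f : C(K, ℝ)) : f.comp (phi 1) = f := rfl

theorem comp_phi_mul (f : C(K, ℝ)) (σ τ : Equiv.Perm Omega2) :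
    f.comp (phi (σ * τ)) = (f.comp (phi τ)).comp (phi σ) := rfl

theorem phi_inv_phi (σ : Equiv.Perm Omega2) (u : K) : phi σ⁻¹ (phi σ u) = u := by
  rw [← ContinuousMap.comp_apply, ← phi_mul, mul_inv_cancel, phi_one_apply]

theorem phi_phi_inv (σ : Equiv.Perm Omega2) (u : K) : phi σ (phi σ⁻¹ u) = u := by
  rw [← ContinuousMap.comp_apply, ← phi_mul, inv_mul_cancel, phi_one_apply]

theorem isOpenMap_phi (σ : Equiv.Perm Omega2) : IsOpenMap (phi σ) := fun O hO => by
  have : phi σ '' O = phi σ⁻¹ ⁻¹' O := by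
    ext u
    constructor
    · rintro ⟨v, hv, rfl⟩
      rwa [mem_preimage, phi_inv_phi]
    · exact fun h => ⟨_, h, phi_phi_inv σ u⟩
  rw [this]
  exact hO.preimage (phi σ⁻¹).continuous

theorem aut_congr {σ τ : Equiv.Perm Omega2} {S : Set Omega2} (h : ∀ a ∈ S, σ a = τ a) {b : Co}
    (hb : b ∈ CoSub S) : aut σ b = aut τ b := by
  apply Heyting.Regular.coe_injective
  ext x
  exact hb _ _ fun ξ hξ => congrArg x (h ξ hξ)

theorem aut_mem_CoSub {σ : Equiv.Perm Omega2} {S : Set Omega2} {b : Co} (hb : b ∈ CoSub S) :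
    aut σ b ∈ CoSub (σ '' S) := fun x y hxy => by
  rw [mem_aut, mem_aut]
  exact hb _ _ fun ξ hξ => hxy _ (mem_image_of_mem σ hξ)

theorem phi_inter_congr {σ τ : Equiv.Perm Omega2} {S : Set Omega2} (h : ∀ a ∈ S, σ a = τ a)
    (u : K) : (phi σ u).1 ∩ CoSub S = (phi τ u).1 ∩ CoSub S := by
  ext b
  refine and_congr_left fun hb => ?_
  rw [mem_phi, mem_phi, aut_congr h hb]

theorem phi_inter_eq {σ : Equiv.Perm Omega2} {S : Set Omega2} {u v : K}
    (h : u.1 ∩ CoSub (σ '' S) = v.1 ∩ CoSub (σ '' S)) :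
    (phi σ u).1 ∩ CoSub S = (phi σ v).1 ∩ CoSub S := by
  ext b
  refine and_congr_left fun hb => ?_
  have := Set.ext_iff.1 h (aut σ b)
  rw [mem_inter_iff, mem_inter_iff, and_iff_left (aut_mem_CoSub hb),
    and_iff_left (aut_mem_CoSub hb)] at this
  exact this

theorem DependsOn.comp_phi_congr {f : C(K, ℝ)} {S : Set Omega2} (hf : DependsOn f S)
    {σ τ : Equiv.Perm Omega2} (h : ∀ a ∈ S, σ a = τ a) : f.comp (phi σ) = f.comp (phi τ) := by
  ext u
  exact hf _ _ (phi_inter_congr h u)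

theorem DependsOn.comp_phi {f : C(K, ℝ)} {S : Set Omega2} (hf : DependsOn f S)
    (σ : Equiv.Perm Omega2) : DependsOn (f.comp (phi σ)) (σ '' S) :=
  fun _ _ h => hf _ _ (phi_inter_eq h)

theorem DependsOn.of_comp_phi {f : C(K, ℝ)} {S : Set Omega2} {σ : Equiv.Perm Omega2}
    (hf : DependsOn (f.comp (phi σ)) S) : DependsOn f (σ ⁻¹' S) := by
  have := hf.comp_phi σ⁻¹
  rw [← comp_phi_mul, inv_mul_cancel, comp_phi_one] at this
  exact this.mono (by
    rintro _ ⟨a, ha, rfl⟩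
    simpa using ha)

/-! ### Suprema of bounded families in `C(K)` -/

section Envelope

variable {ι : Type*} (F : ι → C(K, ℝ))

/-- Values that bound the `F i`, `i ∈ B`, near `u`. -/
def localBounds (B : Set ι) (u : K) : Set ℝ :=
  {r | 0 ≤ r ∧ ∃ O : Set K, IsOpen O ∧ u ∈ O ∧ ∀ v ∈ O, ∀ i ∈ B, F i v ≤ r}

/-- The upper semicontinuous envelope of the pointwise supremum of `0` and the `F i`, `i ∈ B`. -/
def envelope (B : Set ι) (u : K) : ℝ := sInf (localBounds F B u)

variable {F}

theorem localBounds_bddBelow (B : Set ι) (u : K) : BddBelow (localBounds F B u) :=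
  ⟨0, fun _ hr => hr.1⟩

theorem envelope_le {B : Set ι} {O : Set K} (hO : IsOpen O) {r : ℝ} (hr : 0 ≤ r)
    (h : ∀ v ∈ O, ∀ i ∈ B, F i v ≤ r) {u : K} (hu : u ∈ O) : envelope F B u ≤ r :=
  csInf_le (localBounds_bddBelow B u) ⟨hr, O, hO, hu, h⟩

theorem localBounds_nonempty (hF : ∀ i u, F i u ∈ Icc (0 : ℝ) 1) (B : Set ι) (u : K) : (localBounds F B u).Nonempty :=
  ⟨1, zero_le_one, univ, isOpen_univ, mem_univ _, fun v _ i _ => (hF i v).2⟩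

theorem exists_of_envelope_lt (hF : ∀ i u, F i u ∈ Icc (0 : ℝ) 1) {B : Set ι} {u : K} {r : ℝ} (h : envelope F B u < r) :
    ∃ s < r, 0 ≤ s ∧ ∃ O : Set K, IsOpen O ∧ u ∈ O ∧ ∀ v ∈ O, ∀ i ∈ B, F i v ≤ s := by
  obtain ⟨s, hs, hsr⟩ := exists_lt_of_csInf_lt (localBounds_nonempty hF B u) h
  exact ⟨s, hsr, hs.1, hs.2⟩

theorem envelope_mem_Icc (hF : ∀ i u, F i u ∈ Icc (0 : ℝ) 1) (B : Set ι) (u : K) : envelope F B u ∈ Icc (0 : ℝ) 1 :=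
  ⟨le_csInf (localBounds_nonempty hF B u) fun _ hr => hr.1,
    envelope_le isOpen_univ zero_le_one (fun v _ i _ => (hF i v).2) (mem_univ u)⟩

theorem le_envelope (hF : ∀ i u, F i u ∈ Icc (0 : ℝ) 1) {B : Set ι} {i : ι} (hi : i ∈ B) (u : K) : F i u ≤ envelope F B u := by
  refine le_csInf (localBounds_nonempty hF B u) ?_
  rintro r ⟨-, O, -, hu, h⟩
  exact h u hu i hi

theorem envelope_mono (hF : ∀ i u, F i u ∈ Icc (0 : ℝ) 1) {B C : Set ι} (hBC : B ⊆ C) (u : K) : envelope F B u ≤ envelope F C u :=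
  csInf_le_csInf (localBounds_bddBelow B u) (localBounds_nonempty hF C u)
    fun _ ⟨h0, O, hO, hu, h⟩ => ⟨h0, O, hO, hu, fun v hv i hi => h v hv i (hBC hi)⟩

theorem mem_closure_of_lt_envelope {B : Set ι} {u : K} {r : ℝ} (hr : 0 ≤ r)
    (h : r < envelope F B u) : u ∈ closure {v | ∃ i ∈ B, r < F i v} := by
  rw [mem_closure_iff]
  intro O hO hu
  by_contra hne
  refine h.not_ge (envelope_le hO hr (fun v hv i hi => ?_) hu)
  by_contra hlt
  exact hne ⟨v, hv, i, hi, not_le.1 hlt⟩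

theorem isOpen_exists_lt (F : ι → C(K, ℝ)) (B : Set ι) (r : ℝ) :
    IsOpen {v | ∃ i ∈ B, r < F i v} := by
  have : {v | ∃ i ∈ B, r < F i v} = ⋃ i ∈ B, {v | r < F i v} := by
    ext v
    simp
  rw [this]
  exact isOpen_biUnion fun i _ => isOpen_lt continuous_const (F i).continuous

theorem le_envelope_of_mem_closure (hF : ∀ i u, F i u ∈ Icc (0 : ℝ) 1) {B : Set ι} {u : K} {r : ℝ}
    (h : u ∈ closure {v | ∃ i ∈ B, r < F i v}) : r ≤ envelope F B u := by
  refine le_csInf (localBounds_nonempty hF B u) ?_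
  rintro s ⟨-, O, hO, hu, hs⟩
  obtain ⟨v, hv, i, hi, hlt⟩ := mem_closure_iff.1 h O hO hu
  exact hlt.le.trans (hs v hv i hi)

/-- Upper semicontinuity is built into the infimum over neighbourhoods. Lower semicontinuity holds
because the closure of `{v | ∃ i ∈ B, s < F i v}` is open and the envelope is at least `s` on it. -/
theorem continuous_envelope (hF : ∀ i u, F i u ∈ Icc (0 : ℝ) 1) (B : Set ι) : Continuous (envelope F B) := by
  rw [continuous_iff_continuousAt]
  intro u
  refine tendsto_order.2 ⟨fun r hr => ?_, fun r hr => ?_⟩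
  · rcases lt_or_ge r 0 with h0 | h0
    · exact Filter.Eventually.of_forall fun v => h0.trans_le (envelope_mem_Icc hF B v).1
    obtain ⟨s, hrs, hsu⟩ := exists_between hr
    have hu := mem_closure_of_lt_envelope (h0.trans hrs.le) hsu
    filter_upwards [(isOpen_closure_of_isOpen (isOpen_exists_lt F B s)).mem_nhds hu] with v hv
    exact hrs.trans_le (le_envelope_of_mem_closure hF hv)
  · obtain ⟨s, hsr, hs0, O, hO, hu, h⟩ := exists_of_envelope_lt hF hr
    filter_upwards [hO.mem_nhds hu] with v hv
    exact (envelope_le hO hs0 h hv).trans_lt hsr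

/-- The supremum of the `F i`, `i ∈ B`, in `C(K)`. -/
def supr (hF : ∀ i u, F i u ∈ Icc (0 : ℝ) 1) (B : Set ι) : C(K, ℝ) := ⟨envelope F B, continuous_envelope hF B⟩

theorem supr_mem_CI (hF : ∀ i u, F i u ∈ Icc (0 : ℝ) 1) (B : Set ι) : supr hF B ∈ CI K := envelope_mem_Icc hF B

/-- Minimality of the envelope among nonnegative continuous upper bounds: the open set `{k < r}` is
a neighbourhood on which `r` bounds the family. -/
theorem envelope_le_of_le {B : Set ι} {k : C(K, ℝ)} (h0 : ∀ u, 0 ≤ k u)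
    (hk : ∀ i ∈ B, ∀ u, F i u ≤ k u) (u : K) : envelope F B u ≤ k u := by
  refine le_of_forall_gt_imp_ge_of_dense fun r hr => ?_
  exact envelope_le (isOpen_lt k.continuous continuous_const) ((h0 u).trans hr.le)
    (fun v hv j hj => (hk j hj v).trans (le_of_lt hv)) hr

theorem supr_dependsOn (hF : ∀ i u, F i u ∈ Icc (0 : ℝ) 1) {B : Set ι} {S : Set Omega2}
    (hS : ∀ i ∈ B, DependsOn (F i) S) : DependsOn (supr hF B) S := by
  have key : ∀ u v : K, u.1 ∩ CoSub S = v.1 ∩ CoSub S → envelope F B u ≤ envelope F B v := by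
    intro u v huv
    refine le_of_forall_gt_imp_ge_of_dense fun r hr => ?_
    obtain ⟨s, hsr, hs0, O, hO, hv, h⟩ := exists_of_envelope_lt hF hr
    obtain ⟨b, hbv, hbO⟩ := Stone.exists_basic_subset hO hv
    -- The bound near `v` is known only on `[b]`, and `b` need not belong to `Co(S)`. Passing to `e
    -- ∈ Co(S)` spreads the bound over `[e]`.
    obtain ⟨e, heS, hbe, he⟩ := exists_separating (A := univ) S (a := b)
      (fun x y hxy => by rw [show x = y from funext fun ξ => hxy ξ (mem_univ ξ)])
    rw [univ_inter] at heS
    by_contra hlt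
    have hu := mem_closure_of_lt_envelope hs0 (hsr.trans (not_le.1 hlt))
    have hsub : {v | ∃ i ∈ B, s < F i v} ⊆ Stone.basic eᶜ := by
      rintro w ⟨i, hi, hw⟩
      by_contra hwe
      have hwe : e ∈ w.1 := by_contra fun h' => hwe (Stone.mem_compl.2 h')
      -- As `e ∈ w`, the trace of `w` on `Co(S)` is compatible with `b`. An ultrafilter containing
      -- both gives `F i` the same value as `w` does, yet lies in the region where that value is at
      -- most `s`.
      obtain ⟨w', hw'⟩ := Stone.exists_superset (s := {c : Co | ∃ a ∈ w.1 ∩ CoSub S, b ⊓ a = c})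
        ⟨_, ⊤, ⟨w.2.1, top_mem_CoSub S⟩, rfl⟩ (by
          rintro _ ⟨a, ha, rfl⟩ _ ⟨a', ha', rfl⟩
          exact ⟨_, ⟨a ⊓ a', ⟨Stone.mem_inf.2 ⟨ha.1, ha'.1⟩, inf_mem_CoSub ha.2 ha'.2⟩, rfl⟩,
            inf_inf_distrib_left b a a' |>.le⟩) (by
          rintro ⟨a, ha, hab⟩
          exact w.bot_notMem (he a ha.2 hab ▸ Stone.mem_inf.2 ⟨hwe, ha.1⟩))
      have h1 : w'.1 ∩ CoSub S = w.1 ∩ CoSub S :=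
        inter_CoSub_eq fun a ha => (Stone.mem_inf.1 (hw' ⟨a, ha, rfl⟩)).2
      have h2 : b ∈ w'.1 :=
        (Stone.mem_inf.1 (hw' ⟨⊤, ⟨w.2.1, top_mem_CoSub S⟩, rfl⟩)).1
      exact (h w' (hbO h2) i hi).not_gt (hS i hi _ _ h1 ▸ hw)
    have hue : eᶜ ∈ u.1 := closure_minimal hsub (Stone.isClopen_basic _).1 hu
    have hve : eᶜ ∈ v.1 :=
      (Set.ext_iff.1 huv eᶜ |>.1 ⟨hue, compl_mem_CoSub heS⟩).1
    exact Stone.mem_compl.1 hve (v.2.2.1 _ _ hbv hbe)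
  exact fun u v huv => (key u v huv).antisymm (key v u huv.symm)

end Envelope

/-! ### Suprema of disjoint sequences -/

section DisjointSequence

variable {F : ℕ → C(K, ℝ)}

open Classical in
/-- The sum of the `F i` with `i ∈ B` and `i ≤ m`. -/
def partialSum (F : ℕ → C(K, ℝ)) (B : Set ℕ) (m : ℕ) : C(K, ℝ) :=
  ∑ i ∈ (Finset.range (m + 1)).filter (· ∈ B), F i

theorem abs_partialSum_sub_le {B : Set ℕ} {m : ℕ} {u v : K} {δ : ℝ} (hδ : 0 ≤ δ)
    (h : ∀ i ≤ m, |F i u - F i v| ≤ δ) :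
    |partialSum F B m u - partialSum F B m v| ≤ (m + 1) * δ := by
  classical
  rw [partialSum, ContinuousMap.coe_sum, Finset.sum_apply, Finset.sum_apply,
    ← Finset.sum_sub_distrib]
  refine (Finset.abs_sum_le_sum_abs _ _).trans ?_
  refine (Finset.sum_le_card_nsmul _ _ δ fun i hi => h i ?_).trans ?_
  · have := (Finset.mem_filter.1 hi).1
    rw [Finset.mem_range] at this
    omega
  · rw [nsmul_eq_mul]
    refine mul_le_mul_of_nonneg_right ?_ hδ
    have := Finset.card_filter_le (Finset.range (m + 1)) (· ∈ B)
    rw [Finset.card_range] at this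
    exact_mod_cast this

theorem partialSum_eq_zero {B : Set ℕ} {m : ℕ} {u : K} (h : ∀ i ∈ B, i ≤ m → F i u = 0) :
    partialSum F B m u = 0 := by
  classical
  rw [partialSum, ContinuousMap.coe_sum, Finset.sum_apply]
  refine Finset.sum_eq_zero fun i hi => ?_
  rw [Finset.mem_filter, Finset.mem_range] at hi
  exact h i hi.2 (by omega)

theorem partialSum_eq (hd : ∀ i j, i ≠ j → ∀ u, F i u * F j u = 0) {B : Set ℕ} {m j : ℕ} {u : K}
    (hj : j ∈ B) (hjm : j ≤ m) (hu : F j u ≠ 0) : partialSum F B m u = F j u := by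
  classical
  rw [partialSum, ContinuousMap.coe_sum, Finset.sum_apply]
  refine Finset.sum_eq_single j (fun i _ hij => ?_) fun h => ?_
  · exact (mul_eq_zero.1 (hd i j hij u)).resolve_right hu
  · refine (h ?_).elim
    rw [Finset.mem_filter, Finset.mem_range]
    exact ⟨by omega, hj⟩

theorem partialSum_nonneg (hF : ∀ i u, F i u ∈ Icc (0 : ℝ) 1) (B : Set ℕ) (m : ℕ) (u : K) :
    0 ≤ partialSum F B m u := by
  rw [partialSum, ContinuousMap.coe_sum, Finset.sum_apply]
  exact Finset.sum_nonneg fun i _ => (hF i u).1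

theorem le_partialSum (hF : ∀ i u, F i u ∈ Icc (0 : ℝ) 1)
    (hd : ∀ i j, i ≠ j → ∀ u, F i u * F j u = 0) {B : Set ℕ} {m j : ℕ} (hj : j ∈ B) (hjm : j ≤ m)
    (u : K) : F j u ≤ partialSum F B m u := by
  by_cases hu : F j u = 0
  · rw [hu]
    exact partialSum_nonneg hF B m u
  · exact (partialSum_eq hd hj hjm hu).ge

theorem partialSum_le_envelope (hF : ∀ i u, F i u ∈ Icc (0 : ℝ) 1)
    (hd : ∀ i j, i ≠ j → ∀ u, F i u * F j u = 0) (B : Set ℕ) (m : ℕ) (u : K) :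
    partialSum F B m u ≤ envelope F B u := by
  by_cases h : ∀ i ∈ B, i ≤ m → F i u = 0
  · rw [partialSum_eq_zero h]
    exact (envelope_mem_Icc hF B u).1
  · push Not at h
    obtain ⟨j, hj, hjm, hu⟩ := h
    rw [partialSum_eq hd hj hjm hu]
    exact le_envelope hF hj u

/-- If only the first terms survive on an open set, their sum is a continuous bound there, so the
envelope cannot exceed it. -/
theorem envelope_eq_partialSum_of_isOpen (hF : ∀ i u, F i u ∈ Icc (0 : ℝ) 1)
    (hd : ∀ i j, i ≠ j → ∀ u, F i u * F j u = 0) {B : Set ℕ} {m : ℕ} {O : Set K} (hO : IsOpen O)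
    (h : ∀ v ∈ O, ∀ i ∈ B, m < i → F i v = 0) {u : K} (hu : u ∈ O) :
    envelope F B u = partialSum F B m u := by
  refine le_antisymm (le_of_forall_gt_imp_ge_of_dense fun r hr => ?_)
    (partialSum_le_envelope hF hd B m u)
  have h0 := (partialSum_nonneg hF B m u).trans hr.le
  refine envelope_le (O := O ∩ {v | partialSum F B m v < r})
    (hO.inter (isOpen_lt (partialSum F B m).continuous continuous_const)) h0 ?_ ⟨hu, hr⟩
  rintro v ⟨hvO, hv⟩ i hi
  rcases le_or_gt i m with him | him
  · exact (le_partialSum hF hd hi him v).trans (le_of_lt hv)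
  · rw [h v hvO i hi him]
    exact h0

/-- A pointwise form, with no neighbourhood on which later terms vanish. The partial sum plus the
supremum over a tail of `A` is a continuous upper bound, and the tail contributes nothing at `u`.
Since the tail is one of `A`, a single choice of `A` serves all its infinite subsets `B`. -/
theorem envelope_eq_partialSum_of_tail (hF : ∀ i u, F i u ∈ Icc (0 : ℝ) 1)
    (hd : ∀ i j, i ≠ j → ∀ u, F i u * F j u = 0) {A B : Set ℕ} (hBA : B ⊆ A) {u : K}
    (hA : ∃ m, envelope F (A ∩ Ioi m) u = 0) {m : ℕ} (h : ∀ i ∈ B, m < i → F i u = 0) :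
    envelope F B u = partialSum F B m u := by
  refine le_antisymm ?_ (partialSum_le_envelope hF hd B m u)
  obtain ⟨n, hn⟩ := hA
  have h1 : envelope F B u ≤ partialSum F B n u + envelope F (A ∩ Ioi n) u := by
    refine envelope_le_of_le (k := partialSum F B n + supr hF (A ∩ Ioi n))
      (fun v => add_nonneg (partialSum_nonneg hF B n v) (envelope_mem_Icc hF _ v).1)
      (fun i hi v => ?_) u
    rcases le_or_gt i n with hin | hin
    · exact (le_partialSum hF hd hi hin v).trans
        (le_add_of_nonneg_right (envelope_mem_Icc hF _ v).1)
    · exact (le_envelope hF (B := A ∩ Ioi n) ⟨hBA hi, hin⟩ v).trans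
        (le_add_of_nonneg_left (partialSum_nonneg hF B n v))
  rw [hn, add_zero] at h1
  refine h1.trans ?_
  by_cases h2 : ∀ i ∈ B, i ≤ n → F i u = 0
  · rw [partialSum_eq_zero h2]
    exact partialSum_nonneg hF B m u
  · push Not at h2
    obtain ⟨j, hj, hjn, hu⟩ := h2
    rw [partialSum_eq hd hj hjn hu]
    exact le_partialSum hF hd hj (not_lt.1 fun hjm => hu (h j hj hjm)) u

/-- The sets where some `F i` is positive, for `i ∈ A` and for `i ∈ B`, are disjoint and open. In an
extremally disconnected space their closures are disjoint too. -/
theorem envelope_eq_zero_or (hF : ∀ i u, F i u ∈ Icc (0 : ℝ) 1)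
    (hd : ∀ i j, i ≠ j → ∀ u, F i u * F j u = 0) {A B : Set ℕ} (hAB : Disjoint A B) (u : K) :
    envelope F A u = 0 ∨ envelope F B u = 0 := by
  by_contra! h
  have hA := mem_closure_of_lt_envelope le_rfl
    (lt_of_le_of_ne (envelope_mem_Icc hF A u).1 h.1.symm)
  have hB := mem_closure_of_lt_envelope le_rfl
    (lt_of_le_of_ne (envelope_mem_Icc hF B u).1 h.2.symm)
  obtain ⟨v, hvA, hvB⟩ :=
    mem_closure_iff.1 hB _ (isOpen_closure_of_isOpen (isOpen_exists_lt F A 0)) hA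
  obtain ⟨w, ⟨j, hj, hwj⟩, i, hi, hwi⟩ :=
    mem_closure_iff.1 hvA _ (isOpen_exists_lt F B 0) hvB
  exact (mul_pos hwi hwj).ne' (hd i j (fun hij => disjoint_left.1 hAB hi (hij ▸ hj)) w)

/-- Every nonempty open set contains a nonempty open set on which only finitely many `F i ∘ φ(h)`,
`h ∈ J`, do not vanish. -/
theorem exists_isOpen_locallyFinite (hd : ∀ i j, i ≠ j → ∀ u, F i u * F j u = 0) (B : Set ℕ)
    {J : Set (Equiv.Perm Omega2)} (hJ : J.Finite) {O : Set K} (hO : IsOpen O) (hne : O.Nonempty) :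
    ∃ O' ⊆ O, IsOpen O' ∧ O'.Nonempty ∧
      ∃ m, ∀ h ∈ J, ∀ v ∈ O', ∀ i ∈ B, m < i → F i (phi h v) = 0 := by
  induction J, hJ using Set.Finite.induction_on with
  | empty => exact ⟨O, Subset.rfl, hO, hne, 0, by simp⟩
  | @insert h J _ _ ih =>
    obtain ⟨O', hO'O, hO', hne', m, hm⟩ := ih
    -- On the set where one `F j ∘ φ(h)` is nonzero, disjointness makes all the other `F i ∘ φ(h)`
    -- vanish.
    by_cases hz : ∃ v ∈ O', ∃ i ∈ B, F i (phi h v) ≠ 0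
    · obtain ⟨v, hv, j, hj, hvj⟩ := hz
      refine ⟨O' ∩ {w | F j (phi h w) ≠ 0}, inter_subset_left.trans hO'O,
        hO'.inter (isOpen_ne_fun ((F j).comp (phi h)).continuous continuous_const),
        ⟨v, hv, hvj⟩, max m j, ?_⟩
      rintro h' (rfl | hh') w ⟨hw, hwj⟩ i hi him
      · have hij : i ≠ j := by
          rintro rfl
          exact (le_max_right m i).not_gt him
        exact (mul_eq_zero.1 (hd i j hij _)).resolve_right hwj
      · exact hm h' hh' w hw i hi ((le_max_left m j).trans_lt him)
    · push Not at hz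
      refine ⟨O', hO'O, hO', hne', m, ?_⟩
      rintro h' (rfl | hh') w hw i hi him
      · exact hz w hw i hi
      · exact hm h' hh' w hw i hi him

end DisjointSequence

/-! ### Connectedness of `∇F` by chains -/

/-- The point `ΠF u` of `∇F`. -/
def pt (F : Set C(K, ℝ)) (u : K) : nabla F := ⟨PiMap F u, u, rfl⟩

theorem continuous_pt (F : Set C(K, ℝ)) : Continuous (pt F) :=
  Continuous.subtype_mk (continuous_pi fun f => f.1.continuous) _

theorem pt_surjective (F : Set C(K, ℝ)) : Function.Surjective (pt F) := by
  rintro ⟨_, u, rfl⟩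
  exact ⟨u, rfl⟩

instance (F : Set C(K, ℝ)) : CompactSpace (nabla F) :=
  ⟨by
    rw [← (pt_surjective F).range_eq]
    exact isCompact_range (continuous_pt F)⟩

instance : Nonempty K := by
  obtain ⟨u, -⟩ := Stone.basic_nonempty (b := (⊤ : Co)) (fun h =>
    Co.eq_bot_iff.1 h (fun _ => true) trivial)
  exact ⟨u⟩

/-- `u` and `v` are `ε`-close with respect to the functions in `s`. -/
def Close (s : Set C(K, ℝ)) (ε : ℝ) (u v : K) : Prop := ∀ c ∈ s, |c u - c v| < ε

theorem Close.symm {s : Set C(K, ℝ)} {ε : ℝ} {u v : K} (h : Close s ε u v) : Close s ε v u :=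
  fun c hc => abs_sub_comm (c u) (c v) ▸ h c hc

/-- The image in `∇F` of the points reachable from `u` is clopen, because each step may end anywhere
in an open neighbourhood. -/
theorem exists_chain {F : Set C(K, ℝ)} (hF : IsConnected (nabla F)) {s : Set C(K, ℝ)}
    (hsf : s.Finite) (hs : ∀ c ∈ s, ∃ G : C(nabla F, ℝ), ∀ u, c u = G (pt F u)) {ε : ℝ}
    (hε : 0 < ε) (u v : K) : Relation.ReflTransGen (Close s ε) u v := by
  have : ConnectedSpace (nabla F) := isConnected_iff_connectedSpace.1 hF
  choose! G hG using hs
  have hopen : ∀ t : nabla F, IsOpen {t' | ∀ c ∈ s, |G c t - G c t'| < ε} := by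
    intro t
    have : {t' | ∀ c ∈ s, |G c t - G c t'| < ε} = ⋂ c ∈ s, {t' | |G c t - G c t'| < ε} := by
      ext t'
      simp
    rw [this]
    exact hsf.isOpen_biInter fun c _ => isOpen_lt (by fun_prop) continuous_const
  have hclose : ∀ w w', Close s ε w w' ↔ pt F w' ∈ {t' | ∀ c ∈ s, |G c (pt F w) - G c t'| < ε} := by
    intro w w'
    refine forall₂_congr fun c hc => ?_
    rw [hG c hc, hG c hc]
  let R : Set (nabla F) := {t | ∃ w, pt F w = t ∧ Relation.ReflTransGen (Close s ε) u w}
  have hR : ∀ w, pt F w ∈ R ↔ Relation.ReflTransGen (Close s ε) u w := by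
    refine fun w => ⟨?_, fun h => ⟨w, rfl, h⟩⟩
    rintro ⟨w', hw', h⟩
    refine h.tail ((hclose w' w).2 ?_)
    rw [hw']
    simpa using fun _ _ => hε
  have hclopen : IsClopen R := by
    refine ⟨⟨?_⟩, ?_⟩ <;> rw [isOpen_iff_forall_mem_open] <;> intro t ht <;>
      obtain ⟨w, rfl⟩ := pt_surjective F t <;>
      refine ⟨_, ?_, hopen (pt F w), by simpa using fun _ _ => hε⟩ <;> intro t' ht' <;>
      obtain ⟨w', rfl⟩ := pt_surjective F t'
    · intro hw'
      exact ht ((hR w).2 (((hR w').1 hw').tail ((hclose w w').2 ht').symm))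
    · exact (hR w').2 (((hR w).1 ht).tail ((hclose w w').2 ht'))
  have := hclopen.eq_univ ⟨pt F u, (hR u).2 .refl⟩
  exact (hR v).1 (this ▸ mem_univ _)

/-- A continuous two-valued function on `∇F` is, by compactness of `K × K`, unchanged by steps that
are small for finitely many members of `F`; chains then force it to be constant. -/
theorem isConnected_nabla {F : Set C(K, ℝ)}
    (h : ∀ s ⊆ F, s.Finite → ∀ ε > 0, ∀ u v, Relation.ReflTransGen (Close s ε) u v) :
    IsConnected (nabla F) := by
  rw [isConnected_iff_connectedSpace]
  refine @ConnectedSpace.mk _ _ (preconnectedSpace_of_forall_constant ?_)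
    ⟨pt F (Classical.arbitrary K)⟩
  intro k hk t t'
  obtain ⟨u, rfl⟩ := pt_surjective F t
  obtain ⟨v, rfl⟩ := pt_surjective F t'
  let T : Set (K × K) := {z | k (pt F z.1) ≠ k (pt F z.2)}
  have hkc : Continuous fun w => k (pt F w) := hk.comp (continuous_pt F)
  have hT : IsClosed T := by
    have : T = (fun z : K × K => (k (pt F z.1), k (pt F z.2))) ⁻¹' {b | b.1 ≠ b.2} := rfl
    rw [this]
    exact (isClosed_discrete _).preimage
      ((hkc.comp continuous_fst).prodMk (hkc.comp continuous_snd))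
  obtain ⟨I, hI⟩ := hT.isCompact.elim_finite_subfamily_closed
    (fun i : F × ℕ => {z : K × K | |i.1.1 z.1 - i.1.1 z.2| ≤ 1 / (i.2 + 1)})
    (fun i => isClosed_le (by fun_prop) continuous_const) (by
      rw [Set.eq_empty_iff_forall_notMem]
      rintro ⟨w, w'⟩ ⟨hz, hz'⟩
      refine hz (congrArg k (Subtype.ext (funext fun f => ?_)))
      refine eq_of_abs_sub_nonpos (le_of_forall_pos_lt_add fun ε hε => ?_)
      obtain ⟨n, hn⟩ := exists_nat_one_div_lt hε
      rw [zero_add]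
      exact (mem_iInter.1 hz' (f, n)).trans_lt hn)
  obtain ⟨N, hN⟩ := (I.image Prod.snd).exists_le
  have hstep : ∀ w w', Close ((fun i : F × ℕ => i.1.1) '' I) (1 / (N + 1)) w w' →
      k (pt F w) = k (pt F w') := by
    intro w w' hw
    by_contra hne
    refine (Set.eq_empty_iff_forall_notMem.1 hI) (w, w') ⟨hne, mem_iInter₂.2 fun i hi => ?_⟩
    refine (hw i.1.1 ⟨i, hi, rfl⟩).le.trans ?_
    have : (i.2 : ℝ) ≤ N := by exact_mod_cast hN i.2 (Finset.mem_image_of_mem _ hi)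
    exact one_div_le_one_div_of_le (by positivity) (by linarith)
  have hchain := h ((fun i : F × ℕ => i.1.1) '' I) (by rintro _ ⟨i, -, rfl⟩; exact i.1.2)
    (I.finite_toSet.image _) (1 / (N + 1)) (by positivity) u v
  induction hchain with
  | refl => rfl
  | tail _ hw ih => exact ih.trans (hstep _ _ hw)

/-- A finite set of functions in `C(K)` has finite nets. -/
theorem exists_net {s : Set C(K, ℝ)} (hs : s.Finite) {ε : ℝ} (hε : 0 < ε) :
    ∃ N : Set K, N.Finite ∧ ∀ w, ∃ z ∈ N, Close s ε w z := by
  have hopen : ∀ z, IsOpen {w | Close s ε w z} := by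
    intro z
    have : {w | Close s ε w z} = ⋂ c ∈ s, {w | |c w - c z| < ε} := by
      ext w
      simp [Close]
    rw [this]
    exact hs.isOpen_biInter fun c _ => isOpen_lt (by fun_prop) continuous_const
  obtain ⟨t, ht⟩ := isCompact_univ.elim_finite_subcover (fun z => {w | Close s ε w z}) hopen
    fun w _ => mem_iUnion.2 ⟨w, fun c _ => by simpa using hε⟩
  refine ⟨t, t.finite_toSet, fun w => ?_⟩
  simpa using ht (mem_univ w)

/-! ### Room above a countable set of ordinals -/

theorem exists_bound {A : Set Omega2} (hA : A.Countable) (hne : A.Nonempty) :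
    ∃ θ < (Ordinal.omega 2 : Ordinal.{0}), ∀ a ∈ A, a.1 < θ := by
  obtain ⟨f, rfl⟩ := hA.exists_eq_range hne
  -- The supremum stays below `ω₂`, which is regular and so has uncountable cofinality.
  refine ⟨⨆ n, ((f n).1 + 1), ?_, ?_⟩
  · refine Ordinal.iSup_add_one_lt_of_lt_cof ?_ fun n => (f n).2
    have h : Cardinal.IsRegular (Cardinal.aleph 2) := by
      have := Cardinal.isRegular_aleph_add_one 1
      rwa [one_add_one_eq_two] at this
    rw [← Cardinal.ord_aleph, h.cof_ord, Cardinal.mk_nat, ← Cardinal.aleph_zero,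
      Cardinal.aleph_lt_aleph]
    exact two_pos
  · rintro _ ⟨n, rfl⟩
    exact (Order.lt_add_one_iff.2 le_rfl).trans_le
      (le_ciSup (f := fun n => (f n).1 + 1) Ordinal.bddAbove_of_small n)

/-- Disjoint copies of a countable set of ordinals, one above the other and free of limits. -/
theorem exists_copies {A : Set Omega2} (hA : A.Countable) (hne : A.Nonempty) :
    ∃ E : ℕ → Omega2 → Omega2, (∀ a, E 0 a = a) ∧
      (∀ k a n, (E k a).addNat n = E k (a.addNat n)) ∧
      (∀ k a, ¬ Order.IsSuccPrelimit (E (k + 1) a).1) ∧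
      ∀ k k', ∀ a ∈ A, ∀ a' ∈ A, E k a < E k' a' ↔ k < k' ∨ k = k' ∧ a < a' := by
  obtain ⟨θ, hθ, hAθ⟩ := exists_bound hA hne
  have hlt : ∀ (k : ℕ) (a : Omega2), θ * (k + 1 : ℕ) + a.1 + 1 < Ordinal.omega 2 := by
    intro k a
    have h2 : Cardinal.aleph0 ≤ Cardinal.aleph 2 := Cardinal.aleph0_le_aleph 2
    have ha := Cardinal.lt_omega_iff_card_lt.1 a.2
    rw [Cardinal.lt_omega_iff_card_lt] at hθ ⊢
    rw [Ordinal.card_add, Ordinal.card_add, Ordinal.card_mul, Ordinal.card_one, Ordinal.card_nat]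
    exact Cardinal.add_lt_of_lt h2 (Cardinal.add_lt_of_lt h2 (Cardinal.mul_lt_of_lt h2 hθ
      ((Cardinal.natCast_lt_aleph0).trans_le h2)) ha) (Cardinal.one_lt_aleph0.trans_le h2)
  -- The final `+ 1` keeps limit ordinals and `0` out of the copies with index `k + 1`, so a larger
  -- condition owes no new functions `d_ξ`. Finite shifts commute with it, which preserves blocks.
  let E : ℕ → Omega2 → Omega2 := fun k a => Nat.rec a (fun k _ => ⟨_, hlt k a⟩) k
  have hlow : ∀ k a, θ * (k : ℕ) ≤ (E k a).1 := by
    rintro (_ | k) a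
    · simp
    · show θ * (k + 1 : ℕ) ≤ θ * (k + 1 : ℕ) + a.1 + 1
      rw [add_assoc]
      exact le_self_add
  have hhigh : ∀ k, ∀ a ∈ A, ∀ k' > k, ∀ a', (E k a).1 < (E k' a').1 := by
    rintro (_ | k) a ha k' hk a'
    · refine (hAθ a ha).trans_le ((le_mul_of_one_le_right' ?_).trans (hlow k' a'))
      exact_mod_cast hk
    · obtain ⟨k', rfl⟩ : ∃ j, k' = j + 1 := ⟨k' - 1, by omega⟩
      show θ * (k + 1 : ℕ) + a.1 + 1 < θ * (k' + 1 : ℕ) + a'.1 + 1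
      refine (Order.lt_add_one_iff.2 ?_)
      rw [add_assoc]
      calc θ * (k + 1 : ℕ) + (a.1 + 1) ≤ θ * (k + 1 : ℕ) + θ := by
            gcongr
            exact Order.add_one_le_of_lt (hAθ a ha)
        _ = θ * ((k + 1 + 1 : ℕ) : Ordinal) := by
            rw [Nat.cast_add_one (k + 1), mul_add_one]
        _ ≤ θ * (k' + 1 : ℕ) := by
            gcongr
            omega
        _ ≤ _ := le_self_add
  have hmono : ∀ k (a a' : Omega2), a < a' → E k a < E k a' := by
    rintro (_ | k) a a' h
    · exact h
    · show θ * (k + 1 : ℕ) + a.1 + 1 < θ * (k + 1 : ℕ) + a'.1 + 1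
      rw [Order.lt_add_one_iff, Order.add_one_le_iff]
      gcongr
  refine ⟨E, fun _ => rfl, ?_, ?_, ?_⟩
  · rintro (_ | k) a n
    · rfl
    · apply Subtype.ext
      show θ * (k + 1 : ℕ) + a.1 + 1 + n = θ * (k + 1 : ℕ) + (a.1 + n) + 1
      rw [add_assoc _ 1, ← add_assoc _ a.1, add_assoc _ (n : Ordinal)]
      congr 1
      exact_mod_cast Nat.add_comm 1 n
  · intro k a h
    exact Order.not_isSuccPrelimit_add_one _ h
  · intro k k' a ha a' ha'
    rcases lt_trichotomy k k' with h | rfl | h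
    · exact iff_of_true (hhigh k a ha k' h a') (Or.inl h)
    · rcases lt_trichotomy a a' with h | rfl | h
      · exact iff_of_true (hmono k a a' h) (Or.inr ⟨rfl, h⟩)
      · simp
      · refine iff_of_false (hmono k a' a h).not_gt ?_
        simp [h.not_gt]
    · refine iff_of_false (not_lt_of_gt (hhigh k' a' ha' k h a)) ?_
      omega

/-- The permutation that exchanges the values of two injections with disjoint ranges. -/
theorem exists_swap {α ι : Type*} {f g : ι → α} (hf : Function.Injective f)
    (hg : Function.Injective g) (hfg : ∀ i j, f i ≠ g j) :
    ∃ σ : Equiv.Perm α, (∀ i, σ (f i) = g i) ∧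
      ∀ x, (∀ i, x ≠ f i) → (∀ i, x ≠ g i) → σ x = x := by
  classical
  have hinj : Function.Injective (Sum.elim f g) := hf.sumElim hg hfg
  refine ⟨Equiv.Perm.extendDomain (Equiv.sumComm ι ι) (Equiv.ofInjective _ hinj), fun i => ?_,
    fun x hx hx' => ?_⟩
  · exact Equiv.Perm.extendDomain_apply_image (Equiv.sumComm ι ι) (Equiv.ofInjective _ hinj)
      (Sum.inl i)
  · refine Equiv.Perm.extendDomain_apply_not_subtype _ _ ?_
    rintro ⟨i | i, hi⟩
    · exact hx i hi.symm
    · exact hx' i hi.symm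

/-- A map that is injective on a countable set extends, from that set, to a permutation of `ω₂`. -/
theorem exists_perm_extending {X : Set Omega2} (hX : X.Countable) {j : Omega2 → Omega2}
    (hj : InjOn j X) : ∃ π : Equiv.Perm Omega2, ∀ x ∈ X, π x = j x := by
  classical
  have hcard : Cardinal.aleph0 < Cardinal.mk Omega2 := by
    rw [Cardinal.mk_Iio_ordinal, Ordinal.card_omega, Cardinal.lift_aleph, ← Cardinal.aleph_zero,
      Cardinal.aleph_lt_aleph]
    simp
  have : Infinite Omega2 := Cardinal.infinite_iff.2 hcard.le
  have hX' := (Cardinal.le_aleph0_iff_set_countable.2 hX).trans_lt hcard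
  have hjX := (Cardinal.le_aleph0_iff_set_countable.2 (hX.image j)).trans_lt hcard
  -- Both complements have full cardinality, as the sets removed are countable and `ω₂` is not.
  obtain ⟨e⟩ := Cardinal.eq.1 (Cardinal.mk_compl_eq_mk_compl_infinite hX' hjX)
  refine ⟨(Equiv.Set.sumCompl X).symm.trans
    ((Equiv.sumCongr (Equiv.Set.imageOfInjOn j X hj) e).trans (Equiv.Set.sumCompl (j '' X))),
    fun x hx => ?_⟩
  simp [Equiv.Set.sumCompl_symm_apply_of_mem hx, Equiv.Set.imageOfInjOn]

/-! ### Tree-like families of permutations -/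

/-- A set of permutations that copy `A` into a larger countable set, such that any two of
the copies agree on an initial segment of `A` and are disjoint above it. -/
structure MoveSystem (A : Set Omega2) where
  /-- the larger set -/
  carrier : Set Omega2
  /-- an increasing sequence of sets with union `carrier` -/
  level : ℕ → Set Omega2
  /-- the permutations -/
  moves : Set (Equiv.Perm Omega2)
  subset_level : A ⊆ level 0
  level_mono : Monotone level
  iUnion_level : ⋃ n, level n = carrier
  not_subset : ∀ n, ¬ carrier ⊆ level n
  countable_carrier : carrier.Countable
  block : ∀ α ∈ carrier, ∀ n : ℕ, α.addNat n ∈ carrier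
  limit_mem : ∀ ξ ∈ carrier, Order.IsSuccPrelimit ξ.1 → ξ ∈ A
  countable_moves : moves.Countable
  one_mem : 1 ∈ moves
  exists_level : ∀ h ∈ moves, ∃ n, h '' A ⊆ level n
  exists_shift : ∀ J ⊆ moves, J.Finite → ∀ ξ ∈ carrier, ∀ n,
    ∃ σ ∈ Sig ξ (level n) carrier, ∀ h ∈ J, σ * h ∈ moves
  eq_of_apply_eq : ∀ h ∈ moves, ∀ h' ∈ moves, ∀ a ∈ A, ∀ b ∈ A, h a = h' b → a = b
  initial : ∀ h ∈ moves, ∀ h' ∈ moves, ∀ a ∈ A, ∀ b ∈ A, b ≤ a → h a = h' a → h b = h' b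

/-- The permutations obtained from the shifts `σ n ξ`, where `σ n ξ` may be applied once `A` has
been moved into the `n`-th level. -/
inductive Generated (A : Set Omega2) (level : ℕ → Set Omega2) (carrier : Set Omega2)
    (σ : ℕ → Omega2 → Equiv.Perm Omega2) : Equiv.Perm Omega2 → Prop
  | one : Generated A level carrier σ 1
  | shift {h : Equiv.Perm Omega2} (n : ℕ) (ξ : Omega2) : Generated A level carrier σ h →
      h '' A ⊆ level n → ξ ∈ carrier → Generated A level carrier σ (σ n ξ * h)

theorem Generated.countable {A : Set Omega2} {level : ℕ → Set Omega2} {carrier : Set Omega2}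
    (hc : carrier.Countable) (σ : ℕ → Omega2 → Equiv.Perm Omega2) :
    {h | Generated A level carrier σ h}.Countable := by
  have : Countable carrier := hc
  refine (countable_range fun l : List (ℕ × carrier) =>
    (l.map fun z => σ z.1 z.2.1).prod).mono fun h hh => ?_
  induction hh with
  | one => exact ⟨[], rfl⟩
  | shift n ξ _ _ hξ ih =>
    obtain ⟨l, rfl⟩ := ih
    exact ⟨(n, ⟨ξ, hξ⟩) :: l, by simp⟩

theorem nonempty_moveSystem {A : Set Omega2} (hA : A.Countable) (hne : A.Nonempty)
    (hblock : ∀ α ∈ A, ∀ n : ℕ, α.addNat n ∈ A) : Nonempty (MoveSystem A) := by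
  obtain ⟨E, hE0, hEadd, hElim, hElt⟩ := exists_copies hA hne
  have hEinj : ∀ k k', ∀ a ∈ A, ∀ a' ∈ A, E k a = E k' a' → k = k' ∧ a = a' := by
    intro k k' a ha a' ha' h
    have h1 := mt (hElt k k' a ha a' ha').2 h.not_lt
    have h2 := mt (hElt k' k a' ha' a ha).2 h.not_gt
    have h3 : k = k' := by omega
    exact ⟨h3, le_antisymm (not_lt.1 fun h => h2 (Or.inr ⟨h3.symm, h⟩))
      (not_lt.1 fun h => h1 (Or.inr ⟨h3, h⟩))⟩
  let level : ℕ → Set Omega2 := fun n => {x | ∃ k ≤ n, ∃ a ∈ A, x = E k a}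
  let carrier : Set Omega2 := {x | ∃ k, ∃ a ∈ A, x = E k a}
  have hcarrier : carrier.Countable := by
    have : carrier = ⋃ k, E k '' A := by
      ext x
      simp only [carrier, mem_iUnion, mem_image, mem_ofPred_eq, eq_comm]
    rw [this]
    exact countable_iUnion fun k => hA.image _
  obtain ⟨code, hcode⟩ := countable_iff_exists_injOn.1 hcarrier
  -- The index of a fresh copy. It encodes the stage `n`, the threshold `ξ` and the old index `k`,
  -- exceeds `n`, and increases with `k`; thus the last shift applied can be read off from the
  -- result.
  let e : ℕ → ℕ → Omega2 → ℕ := fun n k ξ => Nat.pair (Nat.pair n (code ξ)) k + 1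
  have he_gt : ∀ n k ξ, n < e n k ξ := fun n k ξ =>
    Nat.lt_succ_of_le ((Nat.left_le_pair _ _).trans (Nat.left_le_pair _ _))
  have he_mono : ∀ n k k' ξ, k < k' → e n k ξ < e n k' ξ := fun n k k' ξ h =>
    Nat.succ_lt_succ (Nat.pair_lt_pair_right _ h)
  have he_inj : ∀ n k, ∀ ξ ∈ carrier, ∀ n' k', ∀ ξ' ∈ carrier, e n k ξ = e n' k' ξ' →
      n = n' ∧ k = k' ∧ ξ = ξ' := by
    intro n k ξ hξ n' k' ξ' hξ' h
    obtain ⟨h1, h2⟩ := Nat.pair_eq_pair.1 (Nat.succ_injective h)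
    obtain ⟨h3, h4⟩ := Nat.pair_eq_pair.1 h1
    exact ⟨h3, h2, hcode hξ hξ' h4⟩
  -- The shift swaps the points of the first `n + 1` copies that are at least `ξ` with their
  -- counterparts in fresh copies.
  have hσ : ∀ n ξ, ∃ σ : Equiv.Perm Omega2,
      (∀ k ≤ n, ∀ a ∈ A, ξ ≤ E k a → σ (E k a) = E (e n k ξ) a) ∧
      (∀ x < ξ, σ x = x) ∧ ∀ x ∉ carrier, σ x = x := by
    intro n ξ
    let ι := {z : ℕ × Omega2 // z.1 ≤ n ∧ z.2 ∈ A ∧ ξ ≤ E z.1 z.2}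
    obtain ⟨σ, h1, h2⟩ := exists_swap (ι := ι) (f := fun z => E z.1.1 z.1.2)
      (g := fun z => E (e n z.1.1 ξ) z.1.2)
      (fun z z' h => Subtype.ext (Prod.ext (hEinj _ _ _ z.2.2.1 _ z'.2.2.1 h).1
        (hEinj _ _ _ z.2.2.1 _ z'.2.2.1 h).2))
      (fun z z' h => by
        obtain ⟨h3, h4⟩ := hEinj _ _ _ z.2.2.1 _ z'.2.2.1 h
        exact Subtype.ext (Prod.ext (Nat.pair_eq_pair.1 (Nat.succ_injective h3)).2 h4))
      (fun z z' h => by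
        have h3 := (hEinj _ _ _ z.2.2.1 _ z'.2.2.1 h).1
        have h4 := he_gt n z'.1.1 ξ
        have h5 := z.2.1
        omega)
    refine ⟨σ, fun k hk a ha hξ => h1 ⟨(k, a), hk, ha, hξ⟩, fun x hx => ?_, fun x hx => ?_⟩
    · refine h2 x (fun z h => hx.not_ge (h ▸ z.2.2.2)) fun z h => hx.not_ge ?_
      rw [h]
      refine z.2.2.2.trans (le_of_lt ((hElt _ _ _ z.2.2.1 _ z.2.2.1).2 (Or.inl ?_)))
      exact z.2.1.trans_lt (he_gt _ _ _)
    · exact h2 x (fun z h => hx ⟨_, _, z.2.2.1, h⟩) fun z h => hx ⟨_, _, z.2.2.1, h⟩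
  choose σ hσ1 hσ2 hσ3 using hσ
  have hform : ∀ h, Generated A level carrier σ h →
      (∀ a ∈ A, ∃ k, h a = E k a) ∧ StrictMonoOn h A := by
    intro h hh
    induction hh with
    | one => exact ⟨fun a _ => ⟨0, (hE0 a).symm⟩, fun a _ b _ hab => hab⟩
    | @shift h n ξ hh hn hξ ih =>
      obtain ⟨ih1, ih2⟩ := ih
      have hk : ∀ a ∈ A, ∃ k ≤ n, h a = E k a := by
        intro a ha
        obtain ⟨k, hk⟩ := ih1 a ha
        obtain ⟨k', hk', a', ha', h'⟩ := hn (mem_image_of_mem h ha)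
        exact ⟨k, (hEinj _ _ a ha a' ha' (hk ▸ h')).1 ▸ hk', hk⟩
      constructor
      · intro a ha
        obtain ⟨k, hkn, hk⟩ := hk a ha
        rcases lt_or_ge (h a) ξ with hlt | hge
        · exact ⟨k, by rw [Equiv.Perm.mul_apply, hσ2 _ _ _ hlt, hk]⟩
        · exact ⟨_, by rw [Equiv.Perm.mul_apply, hk, hσ1 _ _ k hkn a ha (hk ▸ hge)]⟩
      · intro a ha b hb hab
        have hlt := ih2 ha hb hab
        obtain ⟨k, hkn, hk⟩ := hk a ha
        obtain ⟨k', hkn', hk'⟩ := ‹∀ a ∈ A, ∃ k ≤ n, h a = E k a› b hb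
        rw [Equiv.Perm.mul_apply, Equiv.Perm.mul_apply]
        rcases lt_or_ge (h b) ξ with hb' | hb'
        · rwa [hσ2 _ _ _ hb', hσ2 _ _ _ (hlt.trans hb')]
        have h1 : σ n ξ (h b) = E (e n k' ξ) b := by
          rw [hk', hσ1 _ _ _ hkn' b hb (hk' ▸ hb')]
        rw [h1]
        rcases lt_or_ge (h a) ξ with ha' | ha'
        · rw [hσ2 _ _ _ ha', hk, hElt _ _ _ ha _ hb]
          exact Or.inl (hkn.trans_lt (he_gt _ _ _))
        · rw [hk, hσ1 _ _ _ hkn a ha (hk ▸ ha'), hElt _ _ _ ha _ hb]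
          rw [hk, hk', hElt _ _ _ ha _ hb] at hlt
          rcases hlt with hlt | ⟨rfl, hlt⟩
          · exact Or.inl (he_mono _ _ _ _ hlt)
          · exact Or.inr ⟨rfl, hlt⟩
  have hlevel : ∀ h, Generated A level carrier σ h → ∃ n, h '' A ⊆ level n := by
    intro h hh
    induction hh with
    | one =>
      refine ⟨0, ?_⟩
      rintro _ ⟨a, ha, rfl⟩
      exact ⟨0, le_rfl, a, ha, (hE0 a).symm⟩
    | @shift h n ξ hh hn hξ ih =>
      refine ⟨e n n ξ, ?_⟩
      rintro _ ⟨a, ha, rfl⟩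
      obtain ⟨k, hk, b, hb, hab⟩ := hn (mem_image_of_mem h ha)
      rw [Equiv.Perm.mul_apply, hab]
      rcases lt_or_ge (E k b) ξ with hlt | hge
      · exact ⟨k, hk.trans (he_gt n n ξ).le, b, hb, hσ2 _ _ _ hlt⟩
      · refine ⟨e n k ξ, ?_, b, hb, hσ1 _ _ k hk b hb hge⟩
        rcases hk.lt_or_eq with hk | rfl
        · exact (he_mono _ _ _ _ hk).le
        · exact le_rfl
  -- Tree property, by induction on both words. A shift with threshold above `h a` changes nothing
  -- up to `a` and can be dropped; if both final shifts act at `a`, the fresh index shows that they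
  -- are the same shift.
  have hinit : ∀ h, Generated A level carrier σ h → ∀ h', Generated A level carrier σ h' →
      ∀ a ∈ A, ∀ b ∈ A, b ≤ a → h a = h' a → h b = h' b := by
    have hone : ∀ h, Generated A level carrier σ h → ∀ a ∈ A, ∀ b ∈ A, b ≤ a → h a = a →
        h b = b := by
      intro h hh a ha b hb hba hab
      rcases hba.lt_or_eq with hba | rfl
      swap
      · exact hab
      have hlt := (hform h hh).2 hb ha hba
      obtain ⟨k, hk⟩ := (hform h hh).1 b hb
      have h0 : h a = E 0 a := by rw [hab, hE0]
      rw [hk, h0, hElt _ _ _ hb _ ha] at hlt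
      obtain rfl : k = 0 := by omega
      rw [hk, hE0]
    have hstep : ∀ h n ξ, Generated A level carrier σ h → h '' A ⊆ level n → ∀ a ∈ A,
        (h a < ξ ∧ ∀ b ∈ A, b ≤ a → (σ n ξ * h) b = h b) ∨
        ∃ k, h a = E k a ∧ (σ n ξ * h) a = E (e n k ξ) a := by
      intro h n ξ hh hn a ha
      rcases lt_or_ge (h a) ξ with hlt | hge
      · exact Or.inl ⟨hlt, fun b hb hba =>
          hσ2 _ _ _ (((hform h hh).2.monotoneOn hb ha hba).trans_lt hlt)⟩
      · obtain ⟨k, hk⟩ := (hform h hh).1 a ha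
        obtain ⟨k', hk', a', ha', h'⟩ := hn (mem_image_of_mem h ha)
        obtain rfl := (hEinj _ _ a ha a' ha' (hk ▸ h')).1
        exact Or.inr ⟨k, hk, by rw [Equiv.Perm.mul_apply, hk, hσ1 _ _ k hk' a ha (hk ▸ hge)]⟩
    intro h hh
    induction hh with
    | one =>
      intro h' hh' a ha b hb hba hab
      exact (hone h' hh' a ha b hb hba hab.symm).symm
    | @shift h n ξ hh hn hξ ih =>
      intro h' hh'
      induction hh' with
      | one =>
        intro a ha b hb hba hab
        exact hone _ (hh.shift n ξ hn hξ) a ha b hb hba hab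
      | @shift h' n' ξ' hh' hn' hξ' ih' =>
        intro a ha b hb hba hab
        rcases hstep h n ξ hh hn a ha with ⟨-, h1⟩ | ⟨k, hk, h1⟩
        · rw [h1 b hb hba]
          exact ih _ (hh'.shift n' ξ' hn' hξ') a ha b hb hba (by rw [← h1 a ha le_rfl, hab])
        rcases hstep h' n' ξ' hh' hn' a ha with ⟨-, h2⟩ | ⟨k', hk', h2⟩
        · rw [h2 b hb hba]
          exact ih' a ha b hb hba (by rw [← h2 a ha le_rfl, hab])
        obtain ⟨rfl, rfl, rfl⟩ := he_inj n k ξ hξ n' k' ξ' hξ'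
          (hEinj _ _ a ha a ha (by rw [← h1, ← h2, hab])).1
        rw [Equiv.Perm.mul_apply, Equiv.Perm.mul_apply,
          ih h' hh' a ha b hb hba (hk.trans hk'.symm)]
  have hmono : Monotone level := fun m n hmn x ⟨k, hk, hx⟩ => ⟨k, hk.trans hmn, hx⟩
  refine ⟨{
    carrier := carrier
    level := level
    moves := {h | Generated A level carrier σ h}
    subset_level := fun a ha => ⟨0, le_rfl, a, ha, (hE0 a).symm⟩
    level_mono := hmono
    iUnion_level := ?_
    not_subset := ?_
    countable_carrier := hcarrier
    block := ?_
    limit_mem := ?_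
    countable_moves := Generated.countable hcarrier σ
    one_mem := .one
    exists_level := hlevel
    exists_shift := ?_
    eq_of_apply_eq := ?_
    initial := fun h hh h' hh' a ha b hb => hinit h hh h' hh' a ha b hb }⟩
  · ext x
    simp only [mem_iUnion]
    exact ⟨fun ⟨n, k, _, hx⟩ => ⟨k, hx⟩, fun ⟨k, hx⟩ => ⟨k, k, le_rfl, hx⟩⟩
  · intro n hn
    obtain ⟨a, ha⟩ := hne
    obtain ⟨k, hk, b, hb, hab⟩ := hn ⟨n + 1, a, ha, rfl⟩
    have := (hEinj _ _ a ha b hb hab).1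
    omega
  · rintro _ ⟨k, a, ha, rfl⟩ n
    exact ⟨k, a.addNat n, hblock a ha n, hEadd k a n⟩
  · rintro _ ⟨k, a, ha, rfl⟩ hlim
    cases k with
    | zero => rwa [hE0]
    | succ k => exact (hElim k a hlim).elim
  · intro J hJ hJf ξ hξ n
    -- The shift is taken at a stage `N` large enough to contain the images under all of `J`; it
    -- then clears level `N` above `ξ`, hence also level `n`.
    have : ∃ N, n ≤ N ∧ ∀ h ∈ J, h '' A ⊆ level N := by
      induction J, hJf using Set.Finite.induction_on with
      | empty => exact ⟨n, le_rfl, by simp⟩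
      | @insert h J _ _ ih =>
        obtain ⟨N, hN, hJN⟩ := ih ((subset_insert h J).trans hJ)
        obtain ⟨m, hm⟩ := hlevel h (hJ (mem_insert h J))
        refine ⟨max N m, hN.trans (le_max_left _ _), ?_⟩
        rintro h' (rfl | hh')
        · exact hm.trans (hmono (le_max_right _ _))
        · exact (hJN h' hh').trans (hmono (le_max_left _ _))
    obtain ⟨N, hN, hJN⟩ := this
    refine ⟨σ N ξ, ⟨?_, ?_⟩, fun h hh => (hJ hh).shift N ξ (hJN h hh) hξ⟩
    · rw [Set.eq_empty_iff_forall_notMem]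
      rintro _ ⟨⟨_, ⟨k, hk, a, ha, rfl⟩, rfl⟩, ⟨k', hk', b, hb, hab⟩, hlt⟩
      rcases lt_or_ge (E k a) ξ with hka | hka
      · rw [hσ2 _ _ _ hka] at hlt
        exact hlt hka
      · rw [hσ1 _ _ _ (hk.trans hN) a ha hka] at hab
        have := (hEinj _ _ a ha b hb hab).1
        have := he_gt N k ξ
        omega
    · rintro γ (hγ | hγ)
      · exact hσ2 _ _ _ hγ
      · exact hσ3 _ _ _ hγ
  · intro h hh h' hh' a ha b hb hab
    obtain ⟨k, hk⟩ := (hform h hh).1 a ha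
    obtain ⟨k', hk'⟩ := (hform h' hh').1 b hb
    exact (hEinj _ _ a ha b hb (by rw [← hk, ← hk', hab])).2

/-! ### Supports, and realization of finitely many moves inside a condition -/

theorem IsIdealOn.biUnion {A : Set Omega2} {I : Set (Set Omega2)} (hI : IsIdealOn A I)
    {ι : Type*} {t : Set ι} (ht : t.Finite) {B : ι → Set Omega2} (hB : ∀ i ∈ t, B i ∈ I) :
    ⋃ i ∈ t, B i ∈ I := by
  induction t, ht using Set.Finite.induction_on with
  | empty => simpa using hI.finite ∅ (empty_subset A) finite_empty
  | @insert i t _ _ ih =>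
    rw [biUnion_insert]
    exact hI.union _ (hB i (mem_insert i t)) _ (ih fun j hj => hB j (mem_insert_of_mem i hj))

theorem DependsOn.biInter {f : C(K, ℝ)} {S : Set Omega2} (hS : DependsOn f S) {ι : Type*}
    {t : Set ι} (ht : t.Finite) {B : ι → Set Omega2} (hB : ∀ i ∈ t, DependsOn f (B i)) :
    DependsOn f (S ∩ ⋂ i ∈ t, B i) := by
  induction t, ht using Set.Finite.induction_on with
  | empty => simpa using hS
  | @insert i t _ _ ih =>
    rw [biInter_insert, inter_left_comm]
    exact (hB i (mem_insert i t)).inter (ih fun j hj => hB j (mem_insert_of_mem i hj))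

theorem PCond.exists_support (p : PCond) {s : Set C(K, ℝ)} (hs : s ⊆ p.F) (hsf : s.Finite) :
    ∃ S ∈ p.I, ∀ f ∈ s, DependsOn f S := by
  have h : ∀ f ∈ s, ∃ S ∈ p.I, DependsOn f S := fun f hf => by
    obtain ⟨S, hS, -, h⟩ := p.depends f (hs hf)
    exact ⟨S, hS, h⟩
  choose! S hS hfS using h
  exact ⟨_, p.ideal.biUnion hsf hS, fun f hf => (hfS f hf).mono (subset_biUnion_of_mem hf)⟩

theorem PCond.support_subset (p : PCond) {f : C(K, ℝ)} (hf : f ∈ p.F) : DependsOn f p.A := by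
  obtain ⟨S, hS, -, h⟩ := p.depends f hf
  exact h.mono (p.ideal.subset S hS)

theorem PCond.A_nonempty (p : PCond) : p.A.Nonempty := by
  rw [nonempty_iff_ne_empty]
  intro h
  exact p.proper (p.ideal.finite _ Subset.rfl (h ▸ finite_empty))

/-- A permutation that fixes all points below `ζ` maps the points above `ζ` to such points. -/
theorem not_lt_of_fixes {σ : Equiv.Perm Omega2} {ζ : Omega2} (hσ : ∀ x < ζ, σ x = x) {x : Omega2}
    (hx : ¬ x < ζ) : ¬ σ x < ζ := fun h => hx (by
  have := σ.injective (hσ _ h)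
  rwa [this] at h)

/-- The joint behaviour of finitely many functions under finitely many moves is realized by
functions of the condition itself. -/
theorem PCond.exists_realization (p : PCond) (M : MoveSystem p.A) {s : Set C(K, ℝ)} (hs : s ⊆ p.F)
    (hsf : s.Finite) (J : Finset (Equiv.Perm Omega2)) (hJ : ↑J ⊆ M.moves) (ξ : Omega2)
    (hξ : ∀ h ∈ J, ∀ h' ∈ J, ∀ a ∈ p.A, a < ξ → h a = h' a) :
    ∃ (σ : Equiv.Perm Omega2 → Equiv.Perm Omega2) (S : Set Omega2), S ⊆ p.A ∧
      (∀ f ∈ s, DependsOn f S) ∧ ∀ h ∈ J, (∀ f ∈ s, f.comp (phi (σ h)) ∈ p.F) ∧ σ h '' S ∈ p.I ∧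
        (∀ x < ξ, σ h x = x) ∧ ∀ h' ∈ J, ∀ a ∈ S, ∀ b ∈ S, σ h a = σ h' b ↔ h a = h' b := by
  classical
  induction J using Finset.strongInduction generalizing ξ with
  | H J ih =>
    by_cases hall : ∀ h ∈ J, ∀ h' ∈ J, ∀ a ∈ p.A, h a = h' a
    · obtain ⟨S, hS, hfS⟩ := p.exists_support hs hsf
      have hSA := p.ideal.subset S hS
      refine ⟨fun _ => 1, S, hSA, hfS, fun h hh => ⟨fun f hf => hs hf, by simpa using hS,
        fun _ _ => rfl, fun h' hh' a ha b hb => ⟨?_, fun hab => ?_⟩⟩⟩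
      · rintro rfl
        exact hall h hh h' hh' a (hSA ha)
      · exact M.eq_of_apply_eq h (hJ hh) h' (hJ hh') a (hSA ha) b (hSA hb) hab
    · push Not at hall
      -- `ζ` is the first point of `p.A` at which members of `J` disagree. By the tree property,
      -- moves with different values at `ζ` have disjoint images from `ζ` on, so `J` splits into two
      -- smaller sets to be separated above `ζ`.
      have hwf := WellFounded.has_min (wellFounded_lt (α := Omega2))
        {a | a ∈ p.A ∧ ∃ h ∈ J, ∃ h' ∈ J, h a ≠ h' a} (by
          obtain ⟨h, hh, h', hh', a, ha, hne⟩ := hall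
          exact ⟨a, ha, h, hh, h', hh', hne⟩)
      obtain ⟨ζ, ⟨hζA, h₁, hh₁, h₂, hh₂, hne⟩, hmin⟩ := hwf
      have hζ : ∀ h ∈ J, ∀ h' ∈ J, ∀ a ∈ p.A, a < ζ → h a = h' a := by
        intro h hh h' hh' a ha hlt
        by_contra hcon
        exact hmin a ⟨ha, h, hh, h', hh', hcon⟩ hlt
      have hξζ : ξ ≤ ζ := not_lt.1 fun hlt => hne (hξ _ hh₁ _ hh₂ ζ hζA hlt)
      let J₁ := J.filter fun h => h ζ = h₁ ζ
      let J₂ := J.filter fun h => ¬ h ζ = h₁ ζ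
      have hJ₁ : J₁ ⊂ J := Finset.filter_ssubset.2 ⟨h₂, hh₂, fun h => hne h.symm⟩
      have hJ₂ : J₂ ⊂ J := Finset.filter_ssubset.2 ⟨h₁, hh₁, fun h => h rfl⟩
      obtain ⟨σ₁, S₁, hS₁, hfS₁, hσ₁⟩ := ih J₁ hJ₁ ((Finset.coe_subset.2 hJ₁.subset).trans hJ) ζ
        fun h hh h' hh' => hζ h (hJ₁.subset hh) h' (hJ₁.subset hh')
      obtain ⟨σ₂, S₂, hS₂, hfS₂, hσ₂⟩ := ih J₂ hJ₂ ((Finset.coe_subset.2 hJ₂.subset).trans hJ) ζ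
        fun h hh h' hh' => hζ h (hJ₂.subset hh) h' (hJ₂.subset hh')
      -- All supports used by the two inductive realizations. Clause (5) for this set gives `ρ`,
      -- which fixes everything below `ζ` and pushes the second realization off both.
      let B : Set Omega2 := (⋃ h ∈ (J₁ : Set (Equiv.Perm Omega2)), σ₁ h '' S₁) ∪
        ⋃ h ∈ (J₂ : Set (Equiv.Perm Omega2)), σ₂ h '' S₂
      have hB : B ∈ p.I := p.ideal.union _
        (p.ideal.biUnion J₁.finite_toSet fun h hh => (hσ₁ h hh).2.1) _
        (p.ideal.biUnion J₂.finite_toSet fun h hh => (hσ₂ h hh).2.1)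
      have hB₁ : ∀ h ∈ J₁, ∀ a ∈ S₁, σ₁ h a ∈ B := fun h hh a ha =>
        Or.inl (mem_biUnion hh (mem_image_of_mem _ ha))
      have hB₂ : ∀ h ∈ J₂, ∀ a ∈ S₂, σ₂ h a ∈ B := fun h hh a ha =>
        Or.inr (mem_biUnion hh (mem_image_of_mem _ ha))
      obtain ⟨ρ, ⟨hρB, hρfix⟩, hρ⟩ := p.moves
        (⋃ h ∈ (J₂ : Set (Equiv.Perm Omega2)), (fun f : C(K, ℝ) => f.comp (phi (σ₂ h))) '' s)
        (iUnion₂_subset fun h hh => by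
          rintro _ ⟨f, hf, rfl⟩
          exact (hσ₂ h hh).1 f hf)
        (J₂.finite_toSet.biUnion fun h _ => hsf.image _) ζ hζA B hB
      have hρfix' : ∀ x < ζ, ρ x = x := fun x hx => hρfix x (Or.inl hx)
      have hρF : ∀ h ∈ J₂, ∀ f ∈ s, f.comp (phi (ρ * σ₂ h)) ∈ p.F := fun h hh f hf =>
        hρ _ (mem_biUnion hh (mem_image_of_mem _ hf))
      have hT : ∀ h ∈ J₂, ∃ T ∈ p.I, ∀ f ∈ s, DependsOn (f.comp (phi (ρ * σ₂ h))) T := by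
        intro h hh
        obtain ⟨T, hT, hfT⟩ := p.exists_support
          (s := (fun f : C(K, ℝ) => f.comp (phi (ρ * σ₂ h))) '' s)
          (by rintro _ ⟨f, hf, rfl⟩; exact hρF h hh f hf) (hsf.image _)
        exact ⟨T, hT, fun f hf => hfT _ (mem_image_of_mem _ hf)⟩
      choose! T hT hfT using hT
      -- The images of `S₂` under `ρ * σ₂ h` need not be in the ideal, but the moved functions lie
      -- in `p.F` and so have supports `T h` there. Pulling these back and intersecting keeps `S` a
      -- support.
      let S := (S₁ ∩ S₂) ∩ ⋂ h ∈ (J₂ : Set (Equiv.Perm Omega2)), (ρ * σ₂ h) ⁻¹' T h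
      have hSS₁ : S ⊆ S₁ := fun a ha => ha.1.1
      have hSS₂ : S ⊆ S₂ := fun a ha => ha.1.2
      have hcross : ∀ h ∈ J₁, ∀ h' ∈ J₂, ∀ a ∈ S, ∀ b ∈ S,
          σ₁ h a = ρ (σ₂ h' b) ↔ h a = h' b := by
        intro h hh h' hh' a ha b hb
        obtain ⟨hhJ, hhζ⟩ := Finset.mem_filter.1 hh
        obtain ⟨hhJ', hhζ'⟩ := Finset.mem_filter.1 hh'
        have hfix₁ := (hσ₁ h hh).2.2.1
        have hfix₂ := (hσ₂ h' hh').2.2.1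
        have haA := hS₁ (hSS₁ ha)
        have hbA := hS₁ (hSS₁ hb)
        constructor
        · intro hab
          by_cases hbζ : b < ζ
          · rw [hfix₂ b hbζ, hρfix' b hbζ] at hab
            have : a = b := (σ₁ h).injective (hab.trans (hfix₁ b hbζ).symm)
            subst this
            exact hζ h hhJ h' hhJ' a haA hbζ
          · exfalso
            have h1 := not_lt_of_fixes hfix₂ hbζ
            have h2 := not_lt_of_fixes hρfix' h1
            refine Set.eq_empty_iff_forall_notMem.1 hρB (ρ (σ₂ h' b))
              ⟨mem_image_of_mem ρ (hB₂ h' hh' b (hSS₂ hb)), ?_, h2⟩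
            rw [← hab]
            exact hB₁ h hh a (hSS₁ ha)
        · intro hab
          obtain rfl := M.eq_of_apply_eq h (hJ hhJ) h' (hJ hhJ') a haA b hbA hab
          have haζ : a < ζ := by
            by_contra hcon
            exact hhζ' (hhζ ▸ (M.initial h (hJ hhJ) h' (hJ hhJ') a haA ζ hζA (not_lt.1 hcon)
              hab).symm)
          rw [hfix₁ a haζ, hfix₂ a haζ, hρfix' a haζ]
      refine ⟨fun h => if h ζ = h₁ ζ then σ₁ h else ρ * σ₂ h, S, hSS₁.trans hS₁,
        fun f hf => ((hfS₁ f hf).inter (hfS₂ f hf)).biInter J₂.finite_toSet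
          fun h hh => (hfT h hh f hf).of_comp_phi, fun h hh => ?_⟩
      by_cases hhζ : h ζ = h₁ ζ
      · have hh1 : h ∈ J₁ := Finset.mem_filter.2 ⟨hh, hhζ⟩
        simp only [if_pos hhζ]
        obtain ⟨hF, hI, hfix, hpat⟩ := hσ₁ h hh1
        refine ⟨hF, p.ideal.mono _ hI _ (image_mono hSS₁), fun x hx => hfix x (hx.trans_le hξζ),
          fun h' hh' a ha b hb => ?_⟩
        by_cases hhζ' : h' ζ = h₁ ζ
        · rw [if_pos hhζ']
          exact hpat h' (Finset.mem_filter.2 ⟨hh', hhζ'⟩) a (hSS₁ ha) b (hSS₁ hb)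
        · rw [if_neg hhζ']
          exact hcross h hh1 h' (Finset.mem_filter.2 ⟨hh', hhζ'⟩) a ha b hb
      · have hh2 : h ∈ J₂ := Finset.mem_filter.2 ⟨hh, hhζ⟩
        simp only [if_neg hhζ]
        obtain ⟨hF, hI, hfix, hpat⟩ := hσ₂ h hh2
        refine ⟨hρF h hh2, p.ideal.mono _ (hT h hh2) _ ?_, fun x hx => ?_,
          fun h' hh' a ha b hb => ?_⟩
        · rintro _ ⟨a, ha, rfl⟩
          exact mem_iInter₂.1 ha.2 h hh2
        · have hx' := hx.trans_le hξζ
          rw [Equiv.Perm.mul_apply, hfix x hx', hρfix' x hx']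
        · by_cases hhζ' : h' ζ = h₁ ζ
          · rw [if_pos hhζ', eq_comm, eq_comm (a := h a)]
            exact hcross h' (Finset.mem_filter.2 ⟨hh', hhζ'⟩) h hh2 b hb a ha
          · rw [if_neg hhζ', Equiv.Perm.mul_apply, Equiv.Perm.mul_apply, ρ.injective.eq_iff]
            exact hpat h' (Finset.mem_filter.2 ⟨hh', hhζ'⟩) a (hSS₂ ha) b (hSS₂ hb)

/-! ### Families of copies: connectedness and simultaneous lifting -/

/-- The functions `f ∘ φ(h)` with `f ∈ G` and `h` a move. -/
def copies (G : Set C(K, ℝ)) (H : Set (Equiv.Perm Omega2)) : Set C(K, ℝ) :=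
  {c | ∃ f ∈ G, ∃ h ∈ H, c = f.comp (phi h)}

theorem copies_eq_image2 (G : Set C(K, ℝ)) (H : Set (Equiv.Perm Omega2)) :
    copies G H = image2 (fun f h => f.comp (phi h)) G H := by
  ext c
  simp only [copies, mem_image2, mem_ofPred_eq, eq_comm]

theorem exists_finite_copies {G : Set C(K, ℝ)} {H : Set (Equiv.Perm Omega2)} {s : Set C(K, ℝ)}
    (hs : s ⊆ copies G H) (hsf : s.Finite) :
    ∃ G' ⊆ G, G'.Finite ∧ ∃ J : Finset (Equiv.Perm Omega2), ↑J ⊆ H ∧ s ⊆ copies G' J := by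
  classical
  have hs' : ∀ c ∈ s, ∃ f ∈ G, ∃ h ∈ H, c = f.comp (phi h) := fun c hc => hs hc
  choose! f hf h hh hc using hs'
  refine ⟨f '' s, ?_, hsf.image f, (hsf.image h).toFinset, ?_, fun c hc' =>
    ⟨f c, mem_image_of_mem f hc', h c, ?_, hc c hc'⟩⟩
  · rintro _ ⟨c, hc', rfl⟩
    exact hf c hc'
  · rw [Finite.coe_toFinset]
    rintro _ ⟨c, hc', rfl⟩
    exact hh c hc'
  · rw [Finite.coe_toFinset]
    exact mem_image_of_mem h hc'

/-- Finitely many copies are carried by one homeomorphism `φ(π)` to members of `p.F`, so chains in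
`∇F_p` can be brought back. -/
theorem PCond.isConnected_copies (p : PCond) (M : MoveSystem p.A) :
    IsConnected (nabla (copies p.F M.moves)) := by
  refine isConnected_nabla fun s hs hsf ε hε => ?_
  obtain ⟨G, hG, hGf, J, hJ, hsJ⟩ := exists_finite_copies hs hsf
  obtain ⟨ξ, -⟩ := p.A_nonempty
  obtain ⟨ξ₀, hξ₀⟩ : ∃ ξ₀ : Omega2, ∀ x, ¬ x < ξ₀ := by
    obtain ⟨m, -, hm⟩ := WellFounded.has_min (wellFounded_lt (α := Omega2)) univ ⟨ξ, trivial⟩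
    exact ⟨m, fun x => hm x trivial⟩
  obtain ⟨σ, S, hS, hfS, hσ⟩ := p.exists_realization M hG hGf J hJ ξ₀
    fun _ _ _ _ a _ ha => (hξ₀ a ha).elim
  -- The rule `h a ↦ σ h a` is well defined and injective precisely because the realization has the
  -- same coincidences as the moves.
  have hπ : ∃ π : Equiv.Perm Omega2, ∀ h ∈ J, ∀ a ∈ S, π (h a) = σ h a := by
    have hX : (⋃ h ∈ (J : Set (Equiv.Perm Omega2)), h '' S).Countable :=
      J.countable_toSet.biUnion fun h _ => (p.countable_A.mono hS).image h
    have hj : ∀ x ∈ ⋃ h ∈ (J : Set (Equiv.Perm Omega2)), h '' S,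
        ∃ y, ∃ h ∈ J, ∃ a ∈ S, h a = x ∧ σ h a = y := by
      intro x hx
      obtain ⟨h, hh, a, ha, rfl⟩ := mem_iUnion₂.1 hx
      exact ⟨_, h, hh, a, ha, rfl, rfl⟩
    choose! j hj using hj
    obtain ⟨π, hπ⟩ := exists_perm_extending hX (j := j) (by
      intro x hx y hy hxy
      obtain ⟨h, hh, a, ha, rfl, h1⟩ := hj x hx
      obtain ⟨h', hh', b, hb, rfl, h2⟩ := hj y hy
      exact ((hσ h hh).2.2.2 h' hh' a ha b hb).1 (by rw [h1, h2, hxy]))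
    refine ⟨π, fun h hh a ha => ?_⟩
    have hx : h a ∈ ⋃ h ∈ (J : Set (Equiv.Perm Omega2)), h '' S :=
      mem_biUnion hh (mem_image_of_mem h ha)
    obtain ⟨h', hh', b, hb, h1, h2⟩ := hj _ hx
    rw [hπ _ hx, ← h2, (hσ h' hh').2.2.2 h hh b hb a ha]
    exact h1
  obtain ⟨π, hπ⟩ := hπ
  have hcomp : ∀ f ∈ G, ∀ h ∈ J, (f.comp (phi h)).comp (phi π) = f.comp (phi (σ h)) := by
    intro f hf h hh
    rw [← comp_phi_mul]
    exact (hfS f hf).comp_phi_congr (hπ h hh)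
  let s' : Set C(K, ℝ) := (fun c : C(K, ℝ) => c.comp (phi π)) '' s
  have hs' : s' ⊆ p.F := by
    rintro _ ⟨c, hc, rfl⟩
    obtain ⟨f, hf, h, hh, rfl⟩ := hsJ hc
    show (f.comp (phi h)).comp (phi π) ∈ p.F
    rw [hcomp f hf h hh]
    exact (hσ h hh).1 f hf
  intro u v
  have hchain := exists_chain p.connected (hsf.image _ : s'.Finite)
    (fun c hc => ⟨⟨fun t => t.1 ⟨c, hs' hc⟩,
      (continuous_apply (A := fun _ : p.F => ℝ) ⟨c, hs' hc⟩).comp continuous_subtype_val⟩, fun u => rfl⟩) hε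
    (phi π⁻¹ u) (phi π⁻¹ v)
  have := hchain.lift (p := Close s ε) (phi π) fun w w' hw c hc => hw _ (mem_image_of_mem _ hc)
  rwa [Function.onFun, phi_phi_inv, phi_phi_inv] at this

/-- Every ultrafilter can be spread over all the copies of `A`. -/
theorem MoveSystem.exists_lift {A : Set Omega2} (M : MoveSystem A) (u : K) :
    ∃ v : K, ∀ h ∈ M.moves, (phi h v).1 ∩ CoSub A = u.1 ∩ CoSub A := by
  classical
  have hfin : ∀ J : Finset (Equiv.Perm Omega2), ↑J ⊆ M.moves →
      ∃ v : K, ∀ h ∈ J, (phi h v).1 ∩ CoSub A = u.1 ∩ CoSub A := by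
    intro J
    induction J using Finset.induction_on with
    | empty => exact fun _ => ⟨u, by simp⟩
    | @insert h J hhJ ih =>
      intro hJ
      rw [Finset.coe_insert, insert_subset_iff] at hJ
      obtain ⟨v, hv⟩ := ih hJ.2
      rcases J.eq_empty_or_nonempty with rfl | hne
      · refine ⟨phi h⁻¹ u, fun h' hh' => ?_⟩
        obtain rfl : h' = h := by simpa using hh'
        rw [phi_phi_inv]
      -- a member of `J` that agrees with `h` as long as possible
      obtain ⟨m, hmJ, hm⟩ : ∃ m ∈ J, ∀ h' ∈ J, ∀ a ∈ A, h a = h' a → h a = m a := by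
        clear hv ih hhJ
        induction hne using Finset.Nonempty.cons_induction with
        | singleton m => exact ⟨m, by simp, fun h' hh' a _ hah => by simp_all⟩
        | cons k J hk hne ih' =>
          have hJ' : ↑J ⊆ M.moves := (Finset.coe_subset.2 (Finset.subset_cons hk)).trans hJ.2
          obtain ⟨m, hmJ, hm⟩ := ih' ⟨hJ.1, hJ'⟩
          by_cases hcmp : ∀ a ∈ A, h a = k a → h a = m a
          · refine ⟨m, Finset.mem_cons_of_mem hmJ, fun h' hh' a ha hah => ?_⟩
            rcases Finset.mem_cons.1 hh' with rfl | hh'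
            · exact hcmp a ha hah
            · exact hm h' hh' a ha hah
          · push Not at hcmp
            obtain ⟨b, hb, hbk, hbm⟩ := hcmp
            have hkM : k ∈ M.moves := hJ.2 (Finset.mem_cons_self k J)
            refine ⟨k, Finset.mem_cons_self k J, fun h' hh' a ha hah => ?_⟩
            rcases Finset.mem_cons.1 hh' with rfl | hh'
            · exact hah
            · have ham := hm h' hh' a ha hah
              rcases le_total a b with hab | hba
              · exact M.initial h hJ.1 k hkM b hb a ha hab hbk
              · exact (hbm (M.initial h hJ.1 m (hJ' hmJ) a ha b hb hba ham)).elim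
      let X : Set Omega2 := ⋃ h' ∈ (J : Set (Equiv.Perm Omega2)), h' '' A
      have hagree : v.1 ∩ CoSub (X ∩ h '' A) = (phi h⁻¹ u).1 ∩ CoSub (X ∩ h '' A) := by
        -- The new copy `h '' A` meets the earlier ones exactly in `h '' Y`, where `h` equals `m`;
        -- the constraint already met along `m` gives the agreement needed to amalgamate.
        let Y : Set Omega2 := {a | a ∈ A ∧ h a = m a}
        have hXY : X ∩ h '' A = h '' Y := by
          ext x
          constructor
          · rintro ⟨hxX, a, ha, rfl⟩
            obtain ⟨h', hh', b, hb, hba⟩ := mem_iUnion₂.1 hxX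
            obtain rfl := M.eq_of_apply_eq h' (hJ.2 hh') h hJ.1 b hb a ha hba
            exact ⟨b, ⟨ha, hm h' hh' b ha hba.symm⟩, rfl⟩
          · rintro ⟨a, ⟨ha, ham⟩, rfl⟩
            exact ⟨mem_biUnion hmJ ⟨a, ha, ham.symm⟩, a, ha, rfl⟩
        rw [hXY]
        ext b
        refine and_congr_left fun hb => ?_
        have hb' : aut h⁻¹ b ∈ CoSub Y := by
          have := aut_mem_CoSub (σ := h⁻¹) hb
          rwa [← image_comp, show (⇑h⁻¹ ∘ ⇑h) = id from funext fun x => h.symm_apply_apply x,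
            image_id] at this
        have hbm : aut m (aut h⁻¹ b) = b := by
          rw [← aut_congr (σ := h) (fun a ha => ha.2) hb', ← aut_mul, mul_inv_cancel]
          rfl
        have h1 := Set.ext_iff.1 (hv m hmJ) (aut h⁻¹ b)
        rw [mem_inter_iff, mem_inter_iff, and_iff_left (CoSub_mono (fun a ha => ha.1) hb'),
          and_iff_left (CoSub_mono (fun a ha => ha.1) hb'), mem_phi, hbm] at h1
        exact h1
      obtain ⟨w, hw1, hw2⟩ := exists_amalgam hagree
      refine ⟨w, fun h' hh' => ?_⟩
      rcases Finset.mem_insert.1 hh' with rfl | hh'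
      · rw [phi_inter_eq hw2, phi_phi_inv]
      · have hsub : h' '' A ⊆ X := fun x hx => mem_biUnion hh' hx
        have : w.1 ∩ CoSub (h' '' A) = v.1 ∩ CoSub (h' '' A) := by
          rw [← inter_eq_self_of_subset_right (CoSub_mono hsub), ← inter_assoc, ← inter_assoc, hw1]
        rw [phi_inter_eq this, hv h' hh']
  have hclosed : ∀ h : M.moves,
      IsClosed {v : K | (phi h.1 v).1 ∩ CoSub A = u.1 ∩ CoSub A} := by
    intro h
    have : {v : K | (phi h.1 v).1 ∩ CoSub A = u.1 ∩ CoSub A} =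
        ⋂ b ∈ u.1 ∩ CoSub A, Stone.basic (aut h.1 b) := by
      ext v
      rw [mem_iInter₂]
      constructor
      · intro hv b hb
        exact ((Set.ext_iff.1 hv b).2 hb).1
      · exact fun hv => inter_CoSub_eq fun b hb => hv b hb
    rw [this]
    exact isClosed_biInter fun b _ => (Stone.isClopen_basic _).1
  obtain ⟨v, -, hv⟩ := isCompact_univ.inter_iInter_nonempty _ hclosed fun J => by
    obtain ⟨v, hv⟩ := hfin (J.map ⟨Subtype.val, Subtype.val_injective⟩) (by
      intro h hh
      obtain ⟨h', -, rfl⟩ := Finset.mem_map.1 (Finset.mem_coe.1 hh)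
      exact h'.2)
    exact ⟨v, trivial, mem_iInter₂.2 fun h hh => hv _ (Finset.mem_map_of_mem _ hh)⟩
  exact ⟨v, fun h hh => mem_iInter.1 hv ⟨h, hh⟩⟩

/-! ### Selection of a thin infinite set of natural numbers -/

theorem exists_infinite_split {S : Set ℕ} (hS : S.Infinite) :
    ∃ T U : Set ℕ, T ∪ U = S ∧ Disjoint T U ∧ T.Infinite ∧ U.Infinite := by
  obtain ⟨T, U, hTU, hd, hc⟩ := hS.exists_union_disjoint_cardinal_eq_of_infinite
  have hiff : T.Infinite ↔ U.Infinite := by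
    rw [← infinite_coe_iff, ← infinite_coe_iff, Cardinal.infinite_iff, Cardinal.infinite_iff, hc]
  have : T.Infinite ∨ U.Infinite := infinite_union.1 (hTU ▸ hS)
  exact ⟨T, U, hTU, hd, by tauto, by tauto⟩

/-- A pseudo-intersection argument: one half of `E` is set aside for the complement, the other is
shrunk successively to meet each `D k`, and a fast diagonal sequence is picked from the resulting
sets. -/
theorem exists_selection_nat {E : Set ℕ} (hE : E.Infinite) {D : ℕ → Set ℕ → Prop}
    (hD : ∀ k A B, Disjoint A B → D k A ∨ D k B) (hmono : ∀ k A B, A ⊆ B → D k B → D k A)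
    {exc : ℕ → ℕ → Set ℕ} (hexc : ∀ r n, (exc r n).Finite) :
    ∃ A ⊆ E, A.Infinite ∧ (E \ A).Infinite ∧ (∀ k, ∃ m, D k (A ∩ Ioi m)) ∧
      ∀ r, ∃ n₀, ∀ n ∈ A, n₀ ≤ n → ∀ i ∈ A, n < i → i ∉ exc r n := by
  obtain ⟨E₀, E₁, hEE, hdisj, hE₀, hE₁⟩ := exists_infinite_split hE
  have hstep : ∀ (k : ℕ) (S : {S : Set ℕ // S.Infinite}),
      ∃ T : {S : Set ℕ // S.Infinite}, T.1 ⊆ S.1 ∧ D k T.1 := by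
    intro k S
    obtain ⟨T, U, hTU, hd, hT, hU⟩ := exists_infinite_split S.2
    rcases hD k T U hd with h | h
    · exact ⟨⟨T, hT⟩, hTU ▸ subset_union_left, h⟩
    · exact ⟨⟨U, hU⟩, hTU ▸ subset_union_right, h⟩
  choose next hnext hDnext using hstep
  let Es : ℕ → {S : Set ℕ // S.Infinite} := fun k => Nat.rec ⟨E₀, hE₀⟩ next k
  have hanti : Antitone fun k => (Es k).1 := antitone_nat_of_succ_le fun k => hnext k (Es k)
  have hbnd : ∀ k n : ℕ, ∃ b, ∀ r ≤ k, ∀ m ≤ n, ∀ i ∈ exc r m, i ≤ b := by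
    intro k n
    obtain ⟨b, hb⟩ := ((finite_Iic k).biUnion fun r _ => (finite_Iic n).biUnion fun m _ =>
      hexc r m).bddAbove
    exact ⟨b, fun r hr m hm i hi => hb (mem_biUnion hr (mem_biUnion hm hi))⟩
  choose bnd hbnd using hbnd
  have hpick : ∀ k n : ℕ, ∃ x ∈ (Es k).1, n < x := fun k n => (Es k).2.exists_gt n
  choose pick hpick hpick' using hpick
  -- Each new term exceeds every exception set with parameters at most `k` that belongs to a number
  -- up to the previous term.
  let a : ℕ → ℕ := fun k => Nat.rec (pick 0 0) (fun k x => pick (k + 1) (max x (bnd k x))) k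
  have ha_mem : ∀ k, a k ∈ (Es k).1 := by
    rintro (_ | k)
    · exact hpick 0 0
    · exact hpick (k + 1) _
  have ha_lt : ∀ k, max (a k) (bnd k (a k)) < a (k + 1) := fun k => hpick' _ _
  have ha : StrictMono a := strictMono_nat_of_lt_succ fun k => (le_max_left _ _).trans_lt (ha_lt k)
  have hsub : range a ⊆ E₀ := by
    rintro _ ⟨k, rfl⟩
    exact hanti (Nat.zero_le k) (ha_mem k)
  refine ⟨range a, hsub.trans (hEE ▸ subset_union_left), infinite_range_of_injective ha.injective,
    hE₁.mono fun x hx => ⟨hEE ▸ Or.inr hx, fun h => disjoint_left.1 hdisj (hsub h) hx⟩,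
    fun k => ⟨a k, hmono k _ _ ?_ (hDnext k (Es k))⟩, fun r => ⟨a r, ?_⟩⟩
  · rintro _ ⟨⟨j, rfl⟩, hj⟩
    exact hanti (Nat.succ_le_of_lt (ha.lt_iff_lt.1 hj)) (ha_mem j)
  · rintro _ ⟨l, rfl⟩ hl _ ⟨j, rfl⟩ hlj hmem
    have h1 := hbnd l (a l) r (ha.le_iff_le.1 hl) (a l) le_rfl _ hmem
    have h2 := ha.monotone (Nat.succ_le_of_lt (ha.lt_iff_lt.1 hlj))
    exact (h1.trans_lt ((le_max_right _ _).trans_lt (ha_lt l))).not_ge h2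

/-- From an infinite set `E` one can select an infinite subset `A` with infinite complement in `E`
that meets countably many splitting requirements up to finite sets, and whose elements avoid given
finite sets that depend on smaller elements. -/
theorem exists_selection {ι κ : Type*} [Countable ι] [Countable κ] {E : Set ℕ} (hE : E.Infinite)
    {D : κ → Set ℕ → Prop} (hD : ∀ k A B, Disjoint A B → D k A ∨ D k B)
    (hmono : ∀ k A B, A ⊆ B → D k B → D k A)
    {exc : ι → ℕ → Set ℕ} (hexc : ∀ r n, (exc r n).Finite) :
    ∃ A ⊆ E, A.Infinite ∧ (E \ A).Infinite ∧ (∀ k, ∃ m, D k (A ∩ Ioi m)) ∧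
      ∀ r, ∃ n₀, ∀ n ∈ A, n₀ ≤ n → ∀ i ∈ A, n < i → i ∉ exc r n := by
  obtain ⟨e, he⟩ := exists_injective_nat ι
  obtain ⟨c, hc⟩ := exists_injective_nat κ
  obtain ⟨A, hAE, hA, hEA, h1, h2⟩ := exists_selection_nat hE
    (D := fun j A => ∀ k, c k = j → D k A) (exc := fun j n => ⋃ r ∈ {r | e r = j}, exc r n) (by
      intro j A B hAB
      by_cases hj : ∃ k, c k = j
      · obtain ⟨k, rfl⟩ := hj
        exact (hD k A B hAB).imp (fun h k' hk' => hc hk' ▸ h) fun h k' hk' => hc hk' ▸ h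
      · exact Or.inl fun k hk => (hj ⟨k, hk⟩).elim)
    (fun j A B hAB h k hk => hmono k A B hAB (h k hk))
    (fun j n => Finite.biUnion (Subsingleton.finite fun r hr r' hr' => he (hr.trans hr'.symm))
      fun r _ => hexc r n)
  refine ⟨A, hAE, hA, hEA, fun k => ?_, fun r => ?_⟩
  · obtain ⟨m, hm⟩ := h1 (c k)
    exact ⟨m, hm k rfl⟩
  · obtain ⟨n₀, hn₀⟩ := h2 (e r)
    refine ⟨n₀, fun n hn hle i hi hlt hmem => hn₀ n hn hle i hi hlt (mem_biUnion ?_ hmem)⟩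
    rfl

/-! ### Adding the supremum of a disjoint sequence -/

section Extension

variable {p : PCond} {M : MoveSystem p.A}

theorem comp_phi_mem_copies {G : Set C(K, ℝ)} {H : Set (Equiv.Perm Omega2)} {f : C(K, ℝ)}
    (hf : f ∈ G) {h : Equiv.Perm Omega2} (hh : h ∈ H) : f.comp (phi h) ∈ copies G H :=
  ⟨f, hf, h, hh, rfl⟩

theorem Finite.copies {G : Set C(K, ℝ)} {H : Set (Equiv.Perm Omega2)} (hG : G.Finite)
    (hH : H.Finite) : (copies G H).Finite := by
  rw [copies_eq_image2]
  exact hG.image2 _ hH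

/-- The map `∇(copies) → ∇F_p` that is given by the copy along `h`. -/
def copyProj (G : Set C(K, ℝ)) {H : Set (Equiv.Perm Omega2)} {h : Equiv.Perm Omega2}
    (hh : h ∈ H) : C(nabla (copies G H), nabla G) where
  toFun t := ⟨fun a => t.1 ⟨a.1.comp (phi h), comp_phi_mem_copies a.2 hh⟩, by
    obtain ⟨_, u, rfl⟩ := t
    exact ⟨phi h u, rfl⟩⟩
  continuous_toFun := by
    refine Continuous.subtype_mk (continuous_pi fun a => ?_) _
    exact (continuous_apply (A := fun _ : copies G H => ℝ)
      ⟨a.1.comp (phi h), comp_phi_mem_copies a.2 hh⟩).comp continuous_subtype_val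

/-- The function on `K` induced by a function on `∇G`. -/
def pull {G : Set C(K, ℝ)} (f : C(nabla G, ℝ)) : C(K, ℝ) := f.comp ⟨pt G, continuous_pt G⟩

theorem pull_apply {G : Set C(K, ℝ)} (f : C(nabla G, ℝ)) (u : K) : pull f u = f (pt G u) := rfl

/-- The functions that have to be approximated at stage `n`. -/
def stage (f : ℕ → C(nabla p.F, ℝ)) (s : Set C(K, ℝ)) (J : Set (Equiv.Perm Omega2)) (n : ℕ) :
    Set C(K, ℝ) :=
  copies s J ∪ copies ((fun i => pull (f i)) '' Iic n) J

theorem finite_stage (f : ℕ → C(nabla p.F, ℝ)) {s : Set C(K, ℝ)} (hs : s.Finite)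
    {J : Set (Equiv.Perm Omega2)} (hJ : J.Finite) (n : ℕ) : (stage f s J n).Finite :=
  (Finite.copies hs hJ).union (Finite.copies ((finite_Iic n).image _) hJ)

theorem stage_factors (M : MoveSystem p.A) (f : ℕ → C(nabla p.F, ℝ)) {s : Set C(K, ℝ)}
    (hs : s ⊆ p.F) {J : Set (Equiv.Perm Omega2)} (hJ : J ⊆ M.moves) {n : ℕ} {c : C(K, ℝ)}
    (hc : c ∈ stage f s J n) :
    ∃ G : C(nabla (copies p.F M.moves), ℝ), ∀ u, c u = G (pt _ u) := by
  rcases hc with ⟨a, ha, h, hh, rfl⟩ | ⟨_, ⟨i, -, rfl⟩, h, hh, rfl⟩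
  · exact ⟨⟨fun t => t.1 ⟨a.comp (phi h), comp_phi_mem_copies (hs ha) (hJ hh)⟩,
      (continuous_apply (A := fun _ : copies p.F M.moves => ℝ) _).comp continuous_subtype_val⟩,
      fun u => rfl⟩
  · exact ⟨(f i).comp (copyProj p.F (hJ hh)), fun u => rfl⟩

variable {f : ℕ → C(nabla p.F, ℝ)}

/-- The hypotheses make every net point at stage `n ∈ A` beyond `n₀` one where the supremum along
each `h ∈ J` is its `n`-th partial sum. Rounding an old chain to the net therefore gives a chain for
the supremum as well. -/
theorem isConnected_copies_insert (M : MoveSystem p.A)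
    (hF : ∀ i u, pull (f i) u ∈ Icc (0 : ℝ) 1)
    (hd : ∀ i j, i ≠ j → ∀ u, pull (f i) u * pull (f j) u = 0) {A B : Set ℕ} (hBA : B ⊆ A)
    (hB : B.Infinite) {N : Set C(K, ℝ) → Set (Equiv.Perm Omega2) → ℕ → ℕ → Set K}
    (hN : ∀ s J, s.Finite → J.Finite → ∀ (k n : ℕ) (w : K),
      ∃ z ∈ N s J k n, Close (stage f s J n) (1 / ((k + 1) * (n + 1))) w z)
    (hexc : ∀ s ⊆ p.F, s.Finite → ∀ J ⊆ M.moves, J.Finite → ∀ k, ∃ n₀, ∀ n ∈ A, n₀ ≤ n →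
      ∀ i ∈ A, n < i → ∀ z ∈ N s J k n, ∀ h ∈ J, pull (f i) (phi h z) = 0)
    (hgood : ∀ s ⊆ p.F, s.Finite → ∀ J ⊆ M.moves, J.Finite → ∀ k n, ∀ z ∈ N s J k n,
      ∀ h ∈ J, ∃ m, envelope (fun i => pull (f i)) (A ∩ Ioi m) (phi h z) = 0) :
    IsConnected (nabla (copies (insert (supr hF B) p.F) M.moves)) := by
  refine isConnected_nabla fun s hs hsf ε hε u v => ?_
  obtain ⟨G, hG, hGf, J, hJ, hsJ⟩ := exists_finite_copies hs hsf
  let s₀ : Set C(K, ℝ) := G ∩ p.F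
  have hs₀ : s₀ ⊆ p.F := inter_subset_right
  have hs₀f : s₀.Finite := hGf.inter_of_left _
  have hJf := J.finite_toSet
  obtain ⟨k, hk⟩ := exists_nat_one_div_lt (show 0 < ε / 3 by positivity)
  obtain ⟨n₀, hn₀⟩ := hexc s₀ hs₀ hs₀f J hJ hJf k
  -- Arbitrary endpoints may have no such truncation, but points on which it is valid are dense.
  have hnear : ∀ u : K, ∃ u', Close s ε u u' ∧ ∃ m, ∀ n ≥ m, ∀ h ∈ J,
      supr hF B (phi h u') = partialSum (fun i => pull (f i)) B n (phi h u') := by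
    intro u
    have hopen : IsOpen {w | Close s ε u w} := by
      have : {w | Close s ε u w} = ⋂ c ∈ s, {w | |c u - c w| < ε} := by
        ext w
        simp [Close]
      rw [this]
      exact hsf.isOpen_biInter fun c _ => isOpen_lt (by fun_prop) continuous_const
    obtain ⟨O, hOs, hO, ⟨u', hu'⟩, m, hm⟩ := exists_isOpen_locallyFinite hd B hJf hopen
      ⟨u, fun c _ => by simpa using hε⟩
    refine ⟨u', hOs hu', m, fun n hn h hh => ?_⟩
    refine envelope_eq_partialSum_of_isOpen hF hd (isOpenMap_phi h O hO) ?_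
      (mem_image_of_mem _ hu')
    rintro _ ⟨w, hw, rfl⟩ i hi hni
    exact hm h hh w hw i hi (lt_of_le_of_lt hn hni)
  obtain ⟨u', huu', mu, hmu⟩ := hnear u
  obtain ⟨v', hvv', mv, hmv⟩ := hnear v
  obtain ⟨n, hnB, hn⟩ := hB.exists_gt (max n₀ (max mu mv))
  rw [max_lt_iff, max_lt_iff] at hn
  set δ : ℝ := 1 / ((k + 1) * (n + 1)) with hδ
  have hδ0 : 0 < δ := by positivity
  -- Two roundings and one chain step cost `3 * δ` per function, and the partial sum has at most `n
  -- + 1` terms.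
  have hδk : (n + 1) * (3 * δ) < ε := by
    have : (n + 1) * (3 * δ) = 3 * (1 / ((k : ℝ) + 1)) := by
      rw [hδ]
      field_simp
    rw [this]
    linarith
  have hδε : 3 * δ < ε := lt_of_le_of_lt
    (le_mul_of_one_le_left (by positivity) (by linarith [(Nat.cast_nonneg n : (0 : ℝ) ≤ n)])) hδk
  have hkey : ∀ w w' : K,
      (∀ h ∈ J, supr hF B (phi h w) = partialSum (fun i => pull (f i)) B n (phi h w)) →
      (∀ h ∈ J, supr hF B (phi h w') = partialSum (fun i => pull (f i)) B n (phi h w')) →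
      (∀ c ∈ stage f s₀ J n, |c w - c w'| ≤ 3 * δ) → Close s ε w w' := by
    intro w w' hw hw' hc c hcs
    obtain ⟨a, ha, h, hh, rfl⟩ := hsJ hcs
    rcases hG ha with rfl | hap
    · rw [ContinuousMap.comp_apply, ContinuousMap.comp_apply, hw h hh, hw' h hh]
      refine (abs_partialSum_sub_le (by positivity) fun i hi => ?_).trans_lt hδk
      have : (pull (f i)).comp (phi h) ∈ stage f s₀ J n :=
        Or.inr (comp_phi_mem_copies (G := (fun i => pull (f i)) '' Iic n) ⟨i, hi, rfl⟩ hh)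
      exact hc _ this
    · have : a.comp (phi h) ∈ stage f s₀ J n :=
        Or.inl (comp_phi_mem_copies (G := s₀) ⟨ha, hap⟩ hh)
      exact (hc _ this).trans_lt hδε
  have hz : ∀ w, ∃ z, Close (stage f s₀ J n) δ w z ∧
      ∀ h ∈ J, supr hF B (phi h z) = partialSum (fun i => pull (f i)) B n (phi h z) := by
    intro w
    obtain ⟨z, hzN, hwz⟩ := hN s₀ J hs₀f hJf k n w
    refine ⟨z, hwz, fun h hh => ?_⟩
    exact envelope_eq_partialSum_of_tail hF hd hBA (hgood s₀ hs₀ hs₀f J hJ hJf k n z hzN h hh)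
      fun i hi hni => hn₀ n (hBA hnB) hn.1.le i (hBA hi) hni z hzN h hh
  choose z hwz hz using hz
  have hchain := exists_chain (p.isConnected_copies M) (finite_stage f hs₀f hJf n)
    (fun c hc => stage_factors M f hs₀ hJ hc) hδ0 u' v'
  have hchain' : Relation.ReflTransGen (Close s ε) (z u') (z v') := by
    refine hchain.lift z fun w w' hww' => hkey _ _ (hz w) (hz w') fun c hc => ?_
    have h1 := abs_lt.1 (hwz w c hc)
    have h2 := abs_lt.1 (hwz w' c hc)
    have h3 := abs_lt.1 (hww' c hc)
    rw [abs_le]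
    constructor <;> linarith
  have hz' : ∀ w, ∀ c ∈ stage f s₀ J n, |c w - c (z w)| ≤ 3 * δ := fun w c hc =>
    (hwz w c hc).le.trans (by linarith)
  have hu : Close s ε u' (z u') := hkey _ _ (hmu n hn.2.1.le) (hz u') (hz' u')
  have hv : Close s ε v' (z v') := hkey _ _ (hmv n hn.2.2.le) (hz v') (hz' v')
  exact (((Relation.ReflTransGen.single huu').tail hu).trans hchain').tail hv.symm |>.tail hvv'.symm

/-! ### Closure relations for lifted points -/

theorem pt_mem_closure {G : Set C(K, ℝ)} {T : Set (nabla G)} {v : K}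
    (h : ∀ s ⊆ G, s.Finite → ∀ ε > 0, ∃ w, pt G w ∈ T ∧ Close s ε w v) :
    pt G v ∈ closure T := by
  have hcl : IsCompact (pt G ⁻¹' closure T) :=
    (isClosed_closure.preimage (continuous_pt G)).isCompact
  obtain ⟨w, hw, hwv⟩ := hcl.inter_iInter_nonempty
    (fun i : G × ℕ => {w | |i.1.1 w - i.1.1 v| ≤ 1 / (i.2 + 1)})
    (fun i => isClosed_le (by fun_prop) continuous_const) (by
      intro I
      obtain ⟨n, hn⟩ := (I.image Prod.snd).exists_le
      obtain ⟨w, hwT, hw⟩ := h ((fun i : G × ℕ => i.1.1) '' I)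
        (by rintro _ ⟨i, -, rfl⟩; exact i.1.2) (I.finite_toSet.image _) (1 / (n + 1))
        (by positivity)
      refine ⟨w, subset_closure hwT, mem_iInter₂.2 fun i hi => ?_⟩
      refine (hw i.1.1 ⟨i, hi, rfl⟩).le.trans ?_
      have : (i.2 : ℝ) ≤ n := by exact_mod_cast hn i.2 (Finset.mem_image_of_mem _ hi)
      exact one_div_le_one_div_of_le (by positivity) (by linarith))
  have : pt G w = pt G v := by
    refine Subtype.ext (funext fun a => ?_)
    refine eq_of_abs_sub_nonpos (le_of_forall_pos_lt_add fun ε hε => ?_)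
    obtain ⟨n, hn⟩ := exists_nat_one_div_lt hε
    rw [zero_add]
    exact (mem_iInter.1 hwv (a, n)).trans_lt hn
  exact this ▸ hw

/-- A point in the closure of `T` remains so after lifting. -/
theorem lift_mem_closure (hF : ∀ i u, pull (f i) u ∈ Icc (0 : ℝ) 1)
    (hd : ∀ i j, i ≠ j → ∀ u, pull (f i) u * pull (f j) u = 0) {A B : Set ℕ} (hBA : B ⊆ A)
    (hB : B.Infinite) {ℓ : nabla p.F → K} (hℓ : ∀ t, ∀ h ∈ M.moves, pt p.F (phi h (ℓ t)) = t)
    {T : Set (nabla p.F)} {y : nabla p.F}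
    (hgood : ∀ t ∈ insert y T, ∀ h ∈ M.moves,
      ∃ m, envelope (fun i => pull (f i)) (A ∩ Ioi m) (phi h (ℓ t)) = 0)
    (happrox : ∀ s ⊆ p.F, s.Finite → ∀ k : ℕ, ∃ n₀, ∀ n ∈ A, n₀ ≤ n → ∃ x ∈ T,
      (∀ a : p.F, a.1 ∈ s → |x.1 a - y.1 a| < 1 / (k + 1)) ∧
      (∀ i ≤ n, |f i x - f i y| < 1 / ((k + 1) * (n + 1))) ∧ ∀ i ∈ A, n < i → f i x = 0) :
    pt (copies (insert (supr hF B) p.F) M.moves) (ℓ y) ∈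
      closure ((fun t => pt (copies (insert (supr hF B) p.F) M.moves) (ℓ t)) '' T) := by
  refine pt_mem_closure fun s hs hsf ε hε => ?_
  obtain ⟨G, hG, hGf, J, hJ, hsJ⟩ := exists_finite_copies hs hsf
  obtain ⟨k, hk⟩ := exists_nat_one_div_lt hε
  obtain ⟨n₀, hn₀⟩ := happrox (G ∩ p.F) inter_subset_right (hGf.inter_of_left _) k
  -- By disjointness at most one `f j` is nonzero at `y`.
  have hm : ∃ m, ∀ i > m, f i y = 0 := by
    by_cases h : ∃ j, f j y ≠ 0
    · obtain ⟨j, hj⟩ := h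
      refine ⟨j, fun i hi => ?_⟩
      have := hd i j (ne_of_gt hi) (ℓ y)
      rw [pull_apply, pull_apply, ← phi_one_apply (ℓ y), hℓ y 1 M.one_mem] at this
      exact (mul_eq_zero.1 this).resolve_right hj
    · push Not at h
      exact ⟨0, fun i _ => h i⟩
  obtain ⟨m, hm⟩ := hm
  obtain ⟨n, hnB, hn⟩ := hB.exists_gt (max n₀ m)
  rw [max_lt_iff] at hn
  obtain ⟨x, hxT, hxy, hfxy, hfx⟩ := hn₀ n (hBA hnB) hn.1.le
  refine ⟨ℓ x, mem_image_of_mem _ hxT, fun c hc => ?_⟩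
  obtain ⟨a, ha, h, hh, rfl⟩ := hsJ hc
  have hpull : ∀ t i, pull (f i) (phi h (ℓ t)) = f i t := fun t i => by
    rw [pull_apply, hℓ t h (hJ hh)]
  rcases hG ha with rfl | hap
  · have hval : ∀ t ∈ insert y T, (∀ i ∈ B, n < i → f i t = 0) → supr hF B (phi h (ℓ t)) =
        partialSum (fun i => pull (f i)) B n (phi h (ℓ t)) := by
      intro t ht ht0
      refine envelope_eq_partialSum_of_tail hF hd hBA (hgood t ht h (hJ hh)) fun i hi hni => ?_
      rw [hpull]
      exact ht0 i hi hni
    rw [ContinuousMap.comp_apply, ContinuousMap.comp_apply,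
      hval x (mem_insert_of_mem y hxT) fun i hi hni => hfx i (hBA hi) hni,
      hval y (mem_insert y T) fun i _ hni => hm i (hn.2.trans hni)]
    refine (abs_partialSum_sub_le (δ := 1 / ((k + 1) * (n + 1))) (by positivity)
      fun i hi => ?_).trans_lt (lt_of_eq_of_lt ?_ hk)
    · rw [hpull, hpull]
      exact (hfxy i hi).le
    · field_simp
  · have hcoord : ∀ t, a (phi h (ℓ t)) = t.1 ⟨a, hap⟩ := fun t =>
      congrFun (congrArg Subtype.val (hℓ t h (hJ hh))) ⟨a, hap⟩
    rw [ContinuousMap.comp_apply, ContinuousMap.comp_apply, hcoord, hcoord]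
    exact (hxy ⟨a, hap⟩ ⟨ha, hap⟩).trans hk

/-! ### The enlarged condition and its supremum -/

/-- The condition obtained by adding all the copies of a function. -/
def PCond.extend (p : PCond) (M : MoveSystem p.A) (g : C(K, ℝ)) (hg : g ∈ CI K)
    (hdep : DependsOn g p.A) (hconn : IsConnected (nabla (copies (insert g p.F) M.moves))) :
    PCond :=
  have hideal : IsIdealOn M.carrier {S | ∃ n, S ⊆ M.level n} :=
    { subset := by
        rintro S ⟨n, hn⟩
        exact M.iUnion_level ▸ hn.trans (subset_iUnion M.level n)
      finite := by
        intro S hS hSf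
        induction S, hSf using Set.Finite.induction_on with
        | empty => exact ⟨0, empty_subset _⟩
        | @insert a S _ _ ih =>
          rw [insert_subset_iff] at hS
          obtain ⟨n, hn⟩ := ih hS.2
          obtain ⟨m, hm⟩ := mem_iUnion.1 (M.iUnion_level.symm ▸ hS.1)
          exact ⟨max m n, insert_subset (M.level_mono (le_max_left m n) hm)
            (hn.trans (M.level_mono (le_max_right m n)))⟩
      union := by
        rintro S ⟨n, hn⟩ T ⟨m, hm⟩
        exact ⟨max n m, union_subset (hn.trans (M.level_mono (le_max_left n m)))
          (hm.trans (M.level_mono (le_max_right n m)))⟩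
      mono := by
        rintro S ⟨n, hn⟩ T hT
        exact ⟨n, hT.trans hn⟩ }
  { A := M.carrier
    F := copies (insert g p.F) M.moves
    I := {S | ∃ n, S ⊆ M.level n}
    countable_A := M.countable_carrier
    block := M.block
    countable_F := by
      rw [copies_eq_image2]
      exact (p.countable_F.insert g).image2 M.countable_moves _
    F_subset := by
      rintro _ ⟨a, ha, h, -, rfl⟩ u
      rcases ha with rfl | ha
      · exact hg _
      · exact p.F_subset ha _
    d_mem := fun ξ hξ hlim =>
      ⟨d ξ, Or.inr (p.d_mem ξ (M.limit_mem ξ hξ hlim) hlim), 1, M.one_mem, rfl⟩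
    ideal := hideal
    proper := fun ⟨n, hn⟩ => M.not_subset n hn
    countablyGenerated := by
      refine ⟨range M.level, ?_, countable_range _, ?_⟩
      · rintro _ ⟨n, rfl⟩
        exact ⟨n, Subset.rfl⟩
      · refine Subset.antisymm ?_ ?_
        · rintro S ⟨T, hT, hTf, hS⟩
          rw [sUnion_eq_biUnion] at hS
          refine hideal.mono _ (hideal.biUnion hTf fun X hX => ?_) S hS
          obtain ⟨n, rfl⟩ := hT hX
          exact ⟨n, Subset.rfl⟩
        · rintro S ⟨n, hn⟩
          exact ⟨{M.level n}, singleton_subset_iff.2 ⟨n, rfl⟩, finite_singleton _, by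
            rwa [sUnion_singleton]⟩
    depends := by
      rintro _ ⟨a, ha, h, hh, rfl⟩
      refine ⟨h '' p.A, M.exists_level h hh, p.countable_A.image h, ?_⟩
      rcases ha with rfl | ha
      · exact hdep.comp_phi h
      · exact (p.support_subset ha).comp_phi h
    moves := by
      rintro s hs hsf ξ hξ S ⟨n, hn⟩
      obtain ⟨G, hG, -, J, hJ, hsJ⟩ := exists_finite_copies hs hsf
      obtain ⟨σ, ⟨hσ1, hσ2⟩, hσ⟩ := M.exists_shift J hJ J.finite_toSet ξ hξ n
      refine ⟨σ, ⟨?_, hσ2⟩, fun c hc => ?_⟩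
      -- The shift was chosen for a whole level; the emptiness it provides passes to subsets of that
      -- level.
      · rw [← subset_empty_iff, ← hσ1]
        exact inter_subset_inter (image_mono hn) (sdiff_subset_sdiff_left hn)
      · obtain ⟨a, ha, h, hh, rfl⟩ := hsJ hc
        exact ⟨a, hG ha, σ * h, hσ h hh, rfl⟩
    connected := hconn }

theorem exists_section (p : PCond) (M : MoveSystem p.A) :
    ∃ ℓ : nabla p.F → K, ∀ t, ∀ h ∈ M.moves, pt p.F (phi h (ℓ t)) = t := by
  have : ∀ t : nabla p.F, ∃ v : K, ∀ h ∈ M.moves, pt p.F (phi h v) = t := by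
    intro t
    obtain ⟨u, rfl⟩ := pt_surjective p.F t
    obtain ⟨v, hv⟩ := M.exists_lift u
    exact ⟨v, fun h hh => Subtype.ext (funext fun a => p.support_subset a.2 _ _ (hv h hh))⟩
  choose ℓ hℓ using this
  exact ⟨ℓ, hℓ⟩

/-- The coordinate function on `∇G`. -/
def coord {G : Set C(K, ℝ)} (g : G) : C(nabla G, ℝ) :=
  ⟨fun t => t.1 g, (continuous_apply g).comp continuous_subtype_val⟩

/-- Any upper bound in `C(∇G')` pulls back to an upper bound in `C(K)`, where the envelope is least,
and `K` maps onto `∇G'`. Nonemptiness of `B` makes the pulled-back bound nonnegative. -/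
theorem isIndestructibleSup_coord (hF : ∀ i u, pull (f i) u ∈ Icc (0 : ℝ) 1) {B : Set ℕ}
    (hB : B.Nonempty) {G : Set C(K, ℝ)} (hpG : p.F ⊆ G) (hg : supr hF B ∈ G) :
    IsIndestructibleSup (fun i : B => (f i).comp (proj hpG)) (coord ⟨supr hF B, hg⟩) := by
  have key : ∀ (G' : Set C(K, ℝ)) (hGG' : G ⊆ G'),
      IsLUB (range fun i : B => ((f i).comp (proj hpG)).comp (proj hGG'))
        ((coord ⟨supr hF B, hg⟩).comp (proj hGG')) := by
    refine fun G' hGG' => ⟨?_, fun k hk => ?_⟩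
    · rintro _ ⟨i, rfl⟩ t
      obtain ⟨u, rfl⟩ := pt_surjective G' t
      exact le_envelope hF i.2 u
    · intro t
      obtain ⟨u, rfl⟩ := pt_surjective G' t
      have hk' : ∀ i ∈ B, ∀ v, pull (f i) v ≤ pull k v := fun i hi v => hk ⟨⟨i, hi⟩, rfl⟩ (pt G' v)
      obtain ⟨j, hj⟩ := hB
      exact envelope_le_of_le (k := pull k) (fun v => (hF j v).1.trans (hk' j hj v)) hk' u
  exact ⟨key G Subset.rfl, fun G' hGG' _ => key G' hGG'⟩

end Extension

/-! ### Extending conditions of `ℚ` -/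

/-- A family indexed by `α` extends to one with dense range, indexed by `α + ω`. -/
theorem exists_dense_extension {X : Type*} [TopologicalSpace X] [SeparableSpace X] [Nonempty X]
    {α : Ordinal.{0}} (x : Iio α → X) :
    ∃ x' : Iio (α + Ordinal.omega0) → X,
      (∀ β : Iio α, x' ⟨β.1, (mem_Iio.1 β.2).trans_le le_self_add⟩ = x β) ∧ DenseRange x' := by
  classical
  refine ⟨fun β => if h : β.1 < α then x ⟨β.1, h⟩ else
    if h : ∃ n : ℕ, β.1 = α + n then denseSeq X h.choose else denseSeq X 0, fun β => ?_, ?_⟩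
  · exact dif_pos β.2
  · refine (denseRange_denseSeq X).mono ?_
    rintro _ ⟨n, rfl⟩
    have hn : α + (n : Ordinal.{0}) < α + Ordinal.omega0 := by
      gcongr
      exact Ordinal.natCast_lt_omega0 n
    refine ⟨⟨α + n, hn⟩, ?_⟩
    have h : ∃ m : ℕ, α + (n : Ordinal.{0}) = α + m := ⟨n, rfl⟩
    have hm : h.choose = n := by
      have := h.choose_spec
      rw [add_right_inj, Nat.cast_inj] at this
      exact this.symm
    refine (dif_neg (not_lt_of_ge le_self_add)).trans ((dif_pos h).trans ?_)
    rw [hm]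

theorem pts_congr {X Y : Type*} {α β : Ordinal.{0}} (hαβ : α ≤ β) {x : Iio α → X} {y : Iio β → Y}
    {g : X → Y} (h : ∀ γ : Iio α, y ⟨γ.1, lt_of_lt_of_le γ.2 hαβ⟩ = g (x γ)) {L : Set Ordinal.{0}}
    (hL : L ⊆ Iio α) : pts y L = g '' pts x L := by
  ext t
  constructor
  · rintro ⟨γ, hγ, rfl⟩
    exact ⟨x ⟨γ.1, hL hγ⟩, ⟨⟨γ.1, hL hγ⟩, hγ, rfl⟩, (h _).symm⟩
  · rintro ⟨_, ⟨γ, hγ, rfl⟩, rfl⟩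
    exact ⟨⟨γ.1, lt_of_lt_of_le γ.2 hαβ⟩, hγ, h γ⟩

/-- Discreteness of a set of points is preserved by lifting the points. -/
theorem discreteTopology_image {X Y : Type*} [TopologicalSpace X] [TopologicalSpace Y] {T : Set X}
    (hT : DiscreteTopology T) {g : X → Y} {r : Y → X} (hr : Continuous r)
    (hrg : ∀ t, r (g t) = t) : DiscreteTopology (g '' T) := by
  have hmem : ∀ y : g '' T, r y.1 ∈ T := by
    rintro ⟨_, t, ht, rfl⟩
    rwa [hrg]
  refine DiscreteTopology.of_continuous_injective (β := T) (f := fun y => ⟨r y.1, hmem y⟩)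
    (Continuous.subtype_mk (hr.comp continuous_subtype_val) _) ?_
  rintro ⟨_, t, ht, rfl⟩ ⟨_, t', ht', rfl⟩ h
  have : r (g t) = r (g t') := congrArg Subtype.val h
  rw [hrg, hrg] at this
  subst this
  rfl

/-- The section `e` transfers old points and, having the projection as a continuous left inverse,
preserves discreteness; only the closure conditions must be assumed. Density is restored by `ω`
further points. -/
theorem QCond.exists_extension (p : QCond) {q₀ : PCond} (hq : q₀ ≤ p.toPCond)
    (e : nabla p.F → nabla q₀.F) (he : ∀ t, proj hq.2.1 (e t) = t)
    (hP : ∀ LR ∈ p.P, (closure (e '' pts p.x LR.1) ∩ closure (e '' pts p.x LR.2)).Nonempty)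
    {L R : Set Ordinal.{0}} (hL : L ⊆ Iio p.α) (hR : R ⊆ Iio p.α) (hLR : Disjoint L R)
    (hLd : DiscreteTopology (pts p.x L)) (hRd : DiscreteTopology (pts p.x R))
    (hLRc : (closure (e '' pts p.x L) ∩ closure (e '' pts p.x R)).Nonempty) :
    ∃ q : QCond, q.toPCond = q₀ ∧ q ≤ p ∧ (L, R) ∈ q.P := by
  have : Countable q₀.F := q₀.countable_F
  have : Nonempty (nabla q₀.F) := q₀.connected.nonempty.to_subtype
  obtain ⟨x, hx, hxd⟩ := exists_dense_extension fun β => e (p.x β)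
  have hα : p.α ≤ p.α + Ordinal.omega0 := le_self_add
  have hpts : ∀ S ⊆ Iio p.α, pts x S = e '' pts p.x S := fun S hS => pts_congr hα hx hS
  have hdisc : ∀ S ⊆ Iio p.α, DiscreteTopology (pts p.x S) → DiscreteTopology (pts x S) := by
    intro S hS hd
    rw [hpts S hS]
    exact discreteTopology_image hd (proj hq.2.1).continuous he
  refine ⟨{
    toPCond := q₀
    α := p.α + Ordinal.omega0
    x := x
    P := insert (L, R) p.P
    α_countable := Ordinal.isPrincipal_add_omega 1 p.α_countable Ordinal.omega0_lt_omega_one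
    dense := hxd
    countable_P := p.countable_P.insert _
    promise_subset := ?_
    promise_disjoint := ?_
    promise_discrete := ?_
    promise_closure := ?_ }, rfl, ⟨hq, hα, subset_insert _ _, fun β => ?_⟩, mem_insert _ _⟩
  · have hsub : Iio p.α ⊆ Iio (p.α + Ordinal.omega0) := Iio_subset_Iio hα
    rintro LR (rfl | h)
    · exact ⟨hL.trans hsub, hR.trans hsub⟩
    · exact (p.promise_subset LR h).imp (fun h => h.trans hsub) fun h => h.trans hsub
  · rintro LR (rfl | h)
    · exact hLR
    · exact p.promise_disjoint LR h
  · rintro LR (rfl | h)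
    · exact ⟨hdisc L hL hLd, hdisc R hR hRd⟩
    · exact ⟨hdisc _ (p.promise_subset LR h).1 (p.promise_discrete LR h).1,
        hdisc _ (p.promise_subset LR h).2 (p.promise_discrete LR h).2⟩
  · rintro LR (rfl | h)
    · rw [hpts L hL, hpts R hR]
      exact hLRc
    · rw [hpts _ (p.promise_subset LR h).1, hpts _ (p.promise_subset LR h).2]
      exact hP LR h
  · exact (congrArg (proj hq.2.1) (hx β)).trans (he _)

theorem exists_close_of_mem_closure {F : Set C(K, ℝ)} {T : Set (nabla F)} {y : nabla F}
    (hy : y ∈ closure T) (f : ℕ → C(nabla F, ℝ)) {s : Set C(K, ℝ)} (hs : s.Finite) (k n : ℕ) :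
    ∃ x ∈ T, (∀ a : F, a.1 ∈ s → |x.1 a - y.1 a| < 1 / (k + 1)) ∧
      ∀ i ≤ n, |f i x - f i y| < 1 / ((k + 1) * (n + 1)) := by
  have h1 : IsOpen {x : nabla F | ∀ a : F, a.1 ∈ s → |x.1 a - y.1 a| < 1 / (k + 1)} := by
    have : {x : nabla F | ∀ a : F, a.1 ∈ s → |x.1 a - y.1 a| < 1 / (k + 1)} =
        ⋂ a ∈ Subtype.val ⁻¹' s, {x : nabla F | |coord a x - coord a y| < 1 / (k + 1)} := by
      ext x
      simp [coord]
    rw [this]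
    exact (hs.preimage Subtype.val_injective.injOn).isOpen_biInter fun a _ =>
      isOpen_lt (by fun_prop) continuous_const
  have h2 : IsOpen {x : nabla F | ∀ i ≤ n, |f i x - f i y| < 1 / ((k + 1) * (n + 1))} := by
    have : {x : nabla F | ∀ i ≤ n, |f i x - f i y| < 1 / ((k + 1) * (n + 1))} =
        ⋂ i ∈ Iic n, {x : nabla F | |f i x - f i y| < 1 / ((k + 1) * (n + 1))} := by
      ext x
      simp
    rw [this]
    exact (finite_Iic n).isOpen_biInter fun a _ => isOpen_lt (by fun_prop) continuous_const
  obtain ⟨x, ⟨hx1, hx2⟩, hxT⟩ := mem_closure_iff.1 hy _ (h1.inter h2)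
    ⟨fun a _ => by simp only [sub_self, abs_zero]; positivity,
      fun i _ => by simp only [sub_self, abs_zero]; positivity⟩
  exact ⟨x, hxT, hx1, hx2⟩

/-- For countably many pairs `y ∈ closure T`, the lifts are constructed for all infinite subsets
of a suitable infinite set `A`. -/
theorem exists_good_set (p : PCond) (M : MoveSystem p.A) (f : ℕ → C(nabla p.F, ℝ))
    (hF : ∀ i u, pull (f i) u ∈ Icc (0 : ℝ) 1)
    (hd : ∀ i j, i ≠ j → ∀ u, pull (f i) u * pull (f j) u = 0)
    {ℓ : nabla p.F → K} (hℓ : ∀ t, ∀ h ∈ M.moves, pt p.F (phi h (ℓ t)) = t)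
    {E : Set ℕ} (hE : E.Infinite) {Y : Set (nabla p.F)} (hY : Y.Countable)
    {ι : Type*} [Countable ι] {T : ι → Set (nabla p.F)} {y : ι → nabla p.F}
    (hT : ∀ i, T i ⊆ Y) (hyY : ∀ i, y i ∈ Y) (hyT : ∀ i, y i ∈ closure (T i)) :
    ∃ A ⊆ E, A.Infinite ∧ (E \ A).Infinite ∧
      (∀ t ∈ Y, ∀ h ∈ M.moves,
        ∃ m, envelope (fun i => pull (f i)) (A ∩ Ioi m) (phi h (ℓ t)) = 0) ∧
      ∀ B ⊆ A, B.Infinite →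
        IsConnected (nabla (copies (insert (supr hF B) p.F) M.moves)) ∧
        ∀ i, pt (copies (insert (supr hF B) p.F) M.moves) (ℓ (y i)) ∈
          closure ((fun t => pt (copies (insert (supr hF B) p.F) M.moves) (ℓ t)) '' T i) := by
  have hN : ∀ (s : Set C(K, ℝ)) (J : Set (Equiv.Perm Omega2)) (k n : ℕ), ∃ N : Set K, N.Finite ∧
      (s.Finite → J.Finite → ∀ w, ∃ z ∈ N, Close (stage f s J n) (1 / ((k + 1) * (n + 1))) w z) := by
    intro s J k n
    by_cases h : s.Finite ∧ J.Finite
    · obtain ⟨N, hN, hNw⟩ := exists_net (finite_stage f h.1 h.2 n)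
        (show (0 : ℝ) < 1 / ((k + 1) * (n + 1)) by positivity)
      exact ⟨N, hN, fun _ _ => hNw⟩
    · exact ⟨∅, finite_empty, fun hs hJ => (h ⟨hs, hJ⟩).elim⟩
  choose N hNf hN using hN
  have hx : ∀ (i : ι) (s : Set C(K, ℝ)) (k n : ℕ), ∃ x ∈ T i, s.Finite →
      (∀ a : p.F, a.1 ∈ s → |x.1 a - (y i).1 a| < 1 / (k + 1)) ∧
      ∀ j ≤ n, |f j x - f j (y i)| < 1 / ((k + 1) * (n + 1)) := by
    intro i s k n
    by_cases h : s.Finite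
    · obtain ⟨x, hx, h1⟩ := exists_close_of_mem_closure (hyT i) f h k n
      exact ⟨x, hx, fun _ => h1⟩
    · obtain ⟨x, hx, -⟩ := exists_close_of_mem_closure (hyT i) f finite_empty k n
      exact ⟨x, hx, fun h' => (h h').elim⟩
  choose x hxT hx using hx
  let FF := {s : Set C(K, ℝ) // s.Finite ∧ s ⊆ p.F}
  let FM := {J : Set (Equiv.Perm Omega2) // J.Finite ∧ J ⊆ M.moves}
  have hFF : Countable FF := (countable_ofPred_finite_subset p.countable_F).to_subtype
  have hFM : Countable FM := (countable_ofPred_finite_subset M.countable_moves).to_subtype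
  -- The countably many points at which a tail supremum has to vanish: translates of all net points,
  -- and of all lifts of points of `Y`.
  let Λ : Set K := (⋃ r : FF × FM × ℕ × ℕ, ⋃ h ∈ M.moves,
    phi h '' N r.1.1 r.2.1.1 r.2.2.1 r.2.2.2) ∪ ⋃ h ∈ M.moves, (fun t => phi h (ℓ t)) '' Y
  have hΛ : Λ.Countable := (countable_iUnion fun r => M.countable_moves.biUnion fun h _ =>
    (hNf _ _ _ _).countable.image _).union (M.countable_moves.biUnion fun h _ => hY.image _)
  have hΛN : ∀ s ⊆ p.F, s.Finite → ∀ J ⊆ M.moves, J.Finite → ∀ k n, ∀ z ∈ N s J k n,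
      ∀ h ∈ J, phi h z ∈ Λ := by
    intro s hs hsf J hJ hJf k n z hz h hh
    exact Or.inl (mem_iUnion.2 ⟨(⟨s, hsf, hs⟩, ⟨J, hJf, hJ⟩, k, n),
      mem_biUnion (hJ hh) (mem_image_of_mem _ hz)⟩)
  have hΛY : ∀ t ∈ Y, ∀ h ∈ M.moves, phi h (ℓ t) ∈ Λ := fun t ht h hh =>
    Or.inr (mem_biUnion hh ⟨t, ht, rfl⟩)
  have : Countable Λ := hΛ
  have hfin : ∀ u : K, {i | pull (f i) u ≠ 0}.Finite := fun u =>
    Subsingleton.finite fun i hi j hj => by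
      by_contra hij
      exact (mul_ne_zero hi hj) (hd i j hij u)
  -- Indices to avoid after `n`: those of functions that do not vanish at a translated net point, or
  -- at the `n`-th approximant of some `y i`. They are finitely many, since each point has at most
  -- one.
  let exc : (FF × FM × ℕ) ⊕ (ι × FF × ℕ) → ℕ → Set ℕ := Sum.elim
    (fun r n => ⋃ z ∈ N r.1.1 r.2.1.1 r.2.2 n, ⋃ h ∈ r.2.1.1, {i | pull (f i) (phi h z) ≠ 0})
    (fun r n => {i | pull (f i) (ℓ (x r.1 r.2.1.1 r.2.2 n)) ≠ 0})
  have hexc : ∀ r n, (exc r n).Finite := by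
    rintro (r | r) n
    · exact (hNf _ _ _ _).biUnion fun z _ => r.2.1.2.1.biUnion fun h _ => hfin _
    · exact hfin _
  obtain ⟨A, hAE, hA, hEA, hgood, hthin⟩ := exists_selection hE
    (D := fun (u : Λ) A => envelope (fun i => pull (f i)) A u.1 = 0)
    (fun u A B hAB => envelope_eq_zero_or hF hd hAB u.1)
    (fun u A B hAB h => le_antisymm (h ▸ envelope_mono hF hAB u.1) (envelope_mem_Icc hF A u.1).1)
    hexc
  refine ⟨A, hAE, hA, hEA, fun t ht h hh => hgood ⟨_, hΛY t ht h hh⟩, fun B hBA hB => ⟨?_, ?_⟩⟩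
  · refine isConnected_copies_insert M hF hd hBA hB (N := N)
      (fun s J hs hJ k n w => hN s J k n hs hJ w) ?_ ?_
    · intro s hs hsf J hJ hJf k
      obtain ⟨n₀, hn₀⟩ := hthin (Sum.inl (⟨s, hsf, hs⟩, ⟨J, hJf, hJ⟩, k))
      refine ⟨n₀, fun n hn hle i hi hni z hz h hh => ?_⟩
      by_contra hne
      exact hn₀ n hn hle i hi hni (mem_biUnion hz (mem_biUnion hh hne))
    · exact fun s hs hsf J hJ hJf k n z hz h hh => hgood ⟨_, hΛN s hs hsf J hJ hJf k n z hz h hh⟩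
  · intro i
    refine lift_mem_closure hF hd hBA hB hℓ (fun t ht h hh => hgood ⟨_, hΛY t ?_ h hh⟩) ?_
    · exact (insert_subset (hyY i) (hT i)) ht
    · intro s hs hsf k
      obtain ⟨n₀, hn₀⟩ := hthin (Sum.inr (i, ⟨s, hsf, hs⟩, k))
      refine ⟨n₀, fun n hn hle => ⟨x i s k n, hxT i s k n, (hx i s k n hsf).1, (hx i s k n hsf).2,
        fun j hj hnj => ?_⟩⟩
      by_contra hne
      refine hn₀ n hn hle j hj hnj ?_
      show pull (f j) (ℓ (x i s k n)) ≠ 0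
      rwa [pull_apply, ← phi_one_apply (ℓ _), hℓ _ 1 M.one_mem]

end ExtLemma

end

/-! ### The main extension lemma -/

theorem mainTheorem3 (p : ExtLemma.QCond)
    (f : ℕ → C(ExtLemma.nabla p.F, ℝ))
    (hf : ∀ n, f n ∈ ExtLemma.CI (ExtLemma.nabla p.F))
    (hdisj : ∀ n m, n ≠ m → ∀ t, f n t * f m t = 0)
    (ξ : ℕ → Set.Iio p.α)
    (hξ : Function.Injective ξ)
    (hdisc : DiscreteTopology (Set.range fun m => p.x (ξ m)))
    (hzero : ∀ n m, f n (p.x (ξ m)) = 0) :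
    ∃ A : Set ℕ, A.Infinite ∧ ∀ A' ⊆ A, A'.Infinite →
      ∃ (q : ExtLemma.QCond) (hqp : q ≤ p),
        (∃ g ∈ ExtLemma.CI (ExtLemma.nabla q.F),
          ExtLemma.IsIndestructibleSup
            (fun i : A' => (f i).comp (ExtLemma.proj (ExtLemma.QCond.F_subset_of_le hqp))) g) ∧
        IsConnected (ExtLemma.nabla q.F) ∧
        ((fun n => (ξ n).1) '' A', (fun n => (ξ n).1) '' A'ᶜ) ∈ q.P := by
  open Set ExtLemma in
  obtain ⟨M⟩ := nonempty_moveSystem p.countable_A p.A_nonempty p.block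
  obtain ⟨ℓ, hℓ⟩ := exists_section p.toPCond M
  have hF : ∀ i u, pull (f i) u ∈ Icc (0 : ℝ) 1 := fun i u => hf i _
  have hd : ∀ i j, i ≠ j → ∀ u, pull (f i) u * pull (f j) u = 0 := fun i j hij u => hdisj i j hij _
  have : Countable p.F := p.countable_F
  -- `∇F_p` is compact and, `F_p` being countable, metrizable. The limit `y₀` will witness the new
  -- promise.
  obtain ⟨y₀, e, he, hlim⟩ := CompactSpace.tendsto_subseq fun n => p.x (ξ n)
  have hy : ∀ LR : p.P, ∃ y, y ∈ closure (pts p.x LR.1.1) ∧ y ∈ closure (pts p.x LR.1.2) :=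
    fun LR => p.promise_closure LR.1 LR.2
  choose y hy₁ hy₂ using hy
  have : Countable p.P := p.countable_P
  have : Countable (Iio p.α) := by
    rw [← Cardinal.mk_le_aleph0_iff, Cardinal.mk_Iio_ordinal, Cardinal.lift_le_aleph0]
    have := Cardinal.lt_omega_iff_card_lt.1 p.α_countable
    rwa [← Cardinal.succ_aleph0, Order.lt_succ_iff] at this
  let Y : Set (nabla p.F) := insert y₀ (range p.x ∪ range y)
  have hpY : range p.x ⊆ Y := fun t ht => Or.inr (Or.inl ht)
  have hpts : ∀ L, pts p.x L ⊆ range p.x := fun L => image_subset_range _ _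
  -- Each old promise enters twice, once for either side, with its common closure point.
  obtain ⟨A, hAE, hA, hEA, hgood, hext⟩ := exists_good_set p.toPCond M f hF hd hℓ
    (infinite_range_of_injective he.injective) (Y := Y)
    (((countable_range _).union (countable_range _)).insert _)
    (ι := p.P × Bool) (T := fun i => pts p.x (if i.2 then i.1.1.1 else i.1.1.2))
    (y := fun i => y i.1) (fun i => (hpts _).trans hpY)
    (fun i => Or.inr (Or.inr ⟨_, rfl⟩)) (by
      rintro ⟨LR, b⟩
      cases b
      · exact hy₂ LR
      · exact hy₁ LR)
  refine ⟨A, hA, fun B hBA hB => ?_⟩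
  obtain ⟨hconn, hprom⟩ := hext B hBA hB
  let q₀ : PCond := p.extend M (supr hF B) (supr_mem_CI hF B)
    (supr_dependsOn hF fun i _ u v huv => congrArg (f i)
      (Subtype.ext (funext fun a => p.support_subset a.2 _ _ huv))) hconn
  have hpq : p.F ⊆ q₀.F := fun a ha => ⟨a, Or.inr ha, 1, M.one_mem, rfl⟩
  have hgq : supr hF B ∈ q₀.F := ⟨_, Or.inl rfl, 1, M.one_mem, rfl⟩
  have hq₀ : q₀ ≤ p.toPCond := by
    refine ⟨?_, hpq, fun S hS => ⟨0, (p.ideal.subset S hS).trans M.subset_level⟩⟩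
    exact (M.subset_level.trans (subset_iUnion M.level 0)).trans M.iUnion_level.subset
  have hnew : ∀ S : Set ℕ, (∀ N, ∃ n ≥ N, e n ∈ S) → pt q₀.F (ℓ y₀) ∈
      closure ((fun t => pt q₀.F (ℓ t)) '' pts p.x ((fun n => (ξ n).1) '' S)) := by
    intro S hS
    refine lift_mem_closure hF hd hBA hB hℓ (fun t ht h hh => hgood t ?_ h hh) ?_
    · rcases ht with rfl | ht
      · exact Or.inl rfl
      · exact hpY (hpts _ ht)
    · intro s hs hsf k
      have hcl : y₀ ∈ closure (pts p.x ((fun n => (ξ n).1) '' S)) := by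
        rw [mem_closure_iff_nhds]
        intro U hU
        obtain ⟨N, hN⟩ := Filter.eventually_atTop.1 (hlim.eventually hU)
        obtain ⟨n, hn, hnS⟩ := hS N
        exact ⟨_, hN n hn, ξ (e n), ⟨e n, hnS, rfl⟩, rfl⟩
      -- No threshold is needed: all `f i` vanish at the points `x_{ξ_m}`, so any approximant will
      -- do, also for indices outside `B`.
      refine ⟨0, fun n _ _ => ?_⟩
      obtain ⟨x, hx, h1, h2⟩ := exists_close_of_mem_closure hcl f hsf k n
      refine ⟨x, hx, h1, h2, fun i _ _ => ?_⟩
      obtain ⟨γ, ⟨m, -, hm⟩, rfl⟩ := hx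
      rw [← Subtype.ext hm]
      exact hzero i m
  have hfreq : ∀ S ⊆ range e, S.Infinite → ∀ N, ∃ n ≥ N, e n ∈ S := by
    intro S hS hSi N
    obtain ⟨m, hm, hlt⟩ := hSi.exists_gt (e N)
    obtain ⟨n, rfl⟩ := hS hm
    exact ⟨n, (he.lt_iff_lt.1 hlt).le, hm⟩
  have hdisc' : ∀ S : Set ℕ, DiscreteTopology (pts p.x ((fun n => (ξ n).1) '' S)) := by
    refine fun S => DiscreteTopology.of_subset hdisc ?_
    rintro _ ⟨γ, ⟨m, -, hm⟩, rfl⟩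
    exact ⟨m, congrArg p.x (Subtype.ext hm)⟩
  have hsub : ∀ S : Set ℕ, (fun n => (ξ n).1) '' S ⊆ Iio p.α := by
    rintro S _ ⟨n, -, rfl⟩
    exact (ξ n).2
  obtain ⟨q, hq, hqp, hqP⟩ := p.exists_extension hq₀ (fun t => pt q₀.F (ℓ t))
    (fun t => hℓ t 1 M.one_mem)
    (fun LR hLR => ⟨pt q₀.F (ℓ (y ⟨LR, hLR⟩)), hprom (⟨LR, hLR⟩, true), hprom (⟨LR, hLR⟩, false)⟩)
    (hsub B) (hsub Bᶜ)
    ((disjoint_image_iff (Subtype.val_injective.comp hξ)).2 disjoint_compl_right)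
    (hdisc' B) (hdisc' Bᶜ)
    -- `B` is infinite inside the subsequence, and its complement contains the infinite set `range e
    -- \ A`, so both sides reach `y₀`.
    ⟨pt q₀.F (ℓ y₀), hnew B (hfreq B (hBA.trans hAE) hB), hnew Bᶜ fun N => by
      obtain ⟨n, hn, hnS⟩ := hfreq _ sdiff_subset hEA N
      exact ⟨n, hn, fun h => hnS.2 (hBA h)⟩⟩
  refine ⟨q, hqp, ?_, q.connected, hqP⟩
  have hqF : q.F = q₀.F := congrArg PCond.F hq
  exact ⟨coord ⟨supr hF B, hqF ▸ hgq⟩, fun t => by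
      obtain ⟨u, rfl⟩ := pt_surjective q.F t
      exact supr_mem_CI hF B u,
    isIndestructibleSup_coord hF hB.nonempty _ _⟩
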